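/- A Pickands dependence function is a convex function $A:[0,1]\to[\tfrac12,1]$ with $\max\{1-t,t\}\le A(t)\le 1$ for all $t\in[0,1]$; its extreme-value copula is $C_A(x,y)=(xy)^{A(\ln x/\ln(xy))}$ on $[0,1]^2$ (with the usual copula boundary values). Kendall's $\tau$ of a copula $C$ is $\tau(C)=4\int_{[0,1]^2}C\,d\mu_C-1$, where $\mu_C$ is the probability measure on $[0,1]^2$ with distribution function $C$. For $v\in[0,1]$ let $\mathcal A^\tau_v$ be the set of all Pickands dependence functions $A$ with $\tau(C_A)=v$. For $y\in[\tfrac12,1]$ let $$L_y(t)=\begin{cases}1-t,&t\in[0,1-y],\\ y,&t\in(1-y,y],\\ t,&t\in(y,1],\end{cases}\qquad T_{1/2,y}(t)=\begin{cases}1-2(1-y)t,&t\in[0,\tfrac12],\\ 1-2(1-y)(1-t),&t\in(\tfrac12,1].\end{cases}$$ **Theorem.** Let $\tau_0\in[0,1]$ be arbitrary but fixed and put $U_{\tau_0}=T_{1/2,\,1-\tau_0/2}$. Then every $A\in\mathcal A^\tau_{\tau_0}$ satisfies $$L_{1/(1+\tau_0)}(t)\le A(t)\le U_{\tau_0}(t)\qquad\text{for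 all }t\in[0,1].$$ Moreover, the region $$\Omega^\tau_{\tau_0}=\big\{(t,y)\in[0,1]\times[\tfrac12,1]:\ L_{1/(1+\tau_0)}(t)\le y\le U_{\tau_0}(t)\big\}$$ is best possible: for each point $(t,y)\in\Omega^\tau_{\tau_0}$ there exists some $A\in\mathcal A^\tau_{\tau_0}$ with $A(t)=y$. -/

import Mathlib

open Set MeasureTheory unitInterval

noncomputable section

/-- Pickands dependence functions: convex functions on `[0,1]` lying between
`max {1 - t, t}` and `1`. Only the values on `[0,1]` matter. -/
structure IsPickands (A : ℝ → ℝ) : Prop where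
  convexOn : ConvexOn ℝ (Icc 0 1) A
  max_le : ∀ t ∈ Icc (0 : ℝ) 1, max (1 - t) t ≤ A t
  le_one : ∀ t ∈ Icc (0 : ℝ) 1, A t ≤ 1

/-- The extreme-value copula `C_A(x,y) = (xy)^{A(ln x / ln (xy))}` on `[0,1]²`.
On the boundary, the conventions `log 0 = 0` and `a / 0 = 0`, together with `A 0 = 1 = A 1`,
give the usual values `C_A(0,y) = C_A(x,0) = 0`, `C_A(1,y) = y` and `C_A(x,1) = x`
(see `evCopula_boundary`). -/
def evCopula (A : ℝ → ℝ) (x y : I) : ℝ :=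
  ((x : ℝ) * y) ^ A (Real.log x / Real.log ((x : ℝ) * y))

/-- `μ` is the measure on `[0,1]²` whose distribution function is `C`. -/
def HasCDF (μ : Measure (I × I)) (C : I → I → ℝ) : Prop :=
  IsProbabilityMeasure μ ∧ ∀ x y : I, μ.real (Iic x ×ˢ Iic y) = C x y

open Classical in
/-- The (doubly stochastic) measure `μ_C` on `[0,1]²` with distribution function `C`. It is unique
by `HasCDF.unique`, and exists for every copula `C`; if `C` is not the distribution function of a
probability measure, the value is the zero measure. -/
def copulaMeasure (C : I → I → ℝ) : Measure (I × I) :=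
  if h : ∃ μ, HasCDF μ C then h.choose else 0

/-- Kendall's tau of a copula, `τ(C) = 4 ∫ C dμ_C - 1`. -/
def kendallTau (C : I → I → ℝ) : ℝ :=
  4 * ∫ p, C p.1 p.2 ∂(copulaMeasure C) - 1

/-- The family of all Pickands dependence functions `A` with `τ(C_A) = v`. -/
def pickandsTau (v : ℝ) : Set (ℝ → ℝ) :=
  {A | IsPickands A ∧ kendallTau (evCopula A) = v}

/-- The tent function `T_{x,y}`. -/
def tentT (x y t : ℝ) : ℝ :=
  if t ≤ x then -((1 - y) / x) * t + 1 else -((1 - y) / (1 - x)) * (1 - t) + 1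

/-- The function `L_y`, that is `1 - t` on `[0, 1 - y]`, `y` on `(1 - y, y]` and `t` on
`(y, 1]`. -/
def lowerL (y t : ℝ) : ℝ :=
  if t ≤ 1 - y then 1 - t else if t ≤ y then y else t

/-- The upper bound `U_v = T_{1/2, 1 - v/2}`. -/
def upperU (v t : ℝ) : ℝ := tentT (1 / 2) (1 - v / 2) t

/-- The region `Ω^τ_v` between the lower bound `L_{1/(1+v)}` and the upper bound `U_v`. -/
def regionTau (v : ℝ) : Set (ℝ × ℝ) :=
  {p | p ∈ Icc (0 : ℝ) 1 ×ˢ Icc (1 / 2 : ℝ) 1 ∧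
    lowerL (1 / (1 + v)) p.1 ≤ p.2 ∧ p.2 ≤ upperU v p.1}

theorem IsPickands.endpoints {A : ℝ → ℝ} (hA : IsPickands A) : A 0 = 1 ∧ A 1 = 1 := by
  have h0 := hA.max_le 0 (by simp)
  have h1 := hA.max_le 1 (by simp)
  have h0' := hA.le_one 0 (by simp)
  have h1' := hA.le_one 1 (by simp)
  norm_num at h0 h1
  exact ⟨le_antisymm h0' h0, le_antisymm h1' h1⟩

theorem evCopula_boundary {A : ℝ → ℝ} (hA : IsPickands A) (x : I) :
    evCopula A 0 x = 0 ∧ evCopula A x 0 = 0 ∧ evCopula A 1 x = x ∧ evCopula A x 1 = x := by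
  obtain ⟨h0, h1⟩ := hA.endpoints
  refine ⟨by simp [evCopula, h0], by simp [evCopula, h0], by simp [evCopula, h0], ?_⟩
  by_cases h : Real.log x = 0
  · simp [evCopula, h, h0]
  · simp [evCopula, div_self h, h1]

theorem HasCDF.unique {μ ν : Measure (I × I)} {C : I → I → ℝ} (hμ : HasCDF μ C)
    (hν : HasCDF ν C) : μ = ν := by
  have := hμ.1
  have := hν.1
  have hs : IsCountablySpanning (range (Iic : I → Set I)) :=
    ⟨fun _ => Iic 1, fun _ => ⟨1, rfl⟩, by
      rw [iUnion_const]; exact eq_univ_of_forall fun x => x.2.2⟩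
  have hg : MeasurableSpace.generateFrom (range (Iic : I → Set I)) =
      (inferInstance : MeasurableSpace I) :=
    (borel_eq_generateFrom_Iic I).symm.trans (BorelSpace.measurable_eq (α := I)).symm
  refine ext_of_generate_finite _ (generateFrom_eq_prod hg hg hs hs).symm
    (isPiSystem_Iic.prod isPiSystem_Iic) ?_ (by simp)
  rintro _ ⟨_, ⟨x, rfl⟩, _, ⟨y, rfl⟩, rfl⟩
  exact (measureReal_eq_measureReal_iff).1 ((hμ.2 x y).trans (hν.2 x y).symm)

theorem HasCDF.copulaMeasure_eq {μ : Measure (I × I)} {C : I → I → ℝ} (hμ : HasCDF μ C) :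
    copulaMeasure C = μ := by
  have h : ∃ μ, HasCDF μ C := ⟨μ, hμ⟩
  rw [copulaMeasure, dif_pos h]
  exact h.choose_spec.unique hμ

end

open Set MeasureTheory unitInterval

noncomputable section

/-! Kendall's tau reverses the order of Pickands functions: if `B ≤ A` then `C_A ≤ C_B`, and `∫ C
dμ_C` increases with `C` because `∫ C dμ_D = ∫ D dμ_C` (`HasCDF.integral_comm`). Both bounds compare
`A` with an explicit function of known tau.

Lower bound: by convexity `A` lies below the tent with vertex `(t, A t)`, whose tau is `(1 - A t) /
A t` (`kendallTau_tentT`), so `(1 - A t) / A t ≤ τ₀`. Upper bound: `A` lies above the maximum of `1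
- t`, `t` and a supporting line at `1/2`. That maximum has tau `2 - (α + β)`, where `α` and `β` are
the values of the line at `1` and `0` (`kendallTau_max_line`). Since `α + β` is twice the value at
`1/2`, this gives `A (1/2) ≤ 1 - τ₀ / 2`, and convexity spreads the bound to all `t`. Sharpness: all
admissible tents of height `1 / (1 + τ₀)` have tau `τ₀`, and moving the vertex sweeps out the
region.

The two values of tau follow from `∫ C dμ_C = 1/2 - ∬ ∂₁C ∂₂C` (`HasCDF.integral_eq_half_sub`), the
copulas being piecewise monomial. Comparison with a general `A` requires that `μ_{C_A}` exists
(`IsPickands.exists_hasCDF`): piecewise linear `A` give products of functions `min (x ^ p) (y ^ q)`,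
and the rest follows by a limit. -/

/-! ### Products of distribution functions and finite max-sums -/

theorem HasCDF.mul {μ ν : Measure (I × I)} {C D : I → I → ℝ} (hμ : HasCDF μ C)
    (hν : HasCDF ν D) :
    HasCDF ((μ.prod ν).map fun p => p.1 ⊔ p.2) (fun x y => C x y * D x y) := by
  have := hμ.1
  have := hν.1
  have hm : Measurable fun p : (I × I) × (I × I) => p.1 ⊔ p.2 := by
    exact (measurable_fst.fst.sup measurable_snd.fst).prodMk
      (measurable_fst.snd.sup measurable_snd.snd)
  refine ⟨Measure.isProbabilityMeasure_map hm.aemeasurable, fun x y => ?_⟩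
  -- The maximum of two independent vectors lies in a lower box iff both vectors do.
  have hs : (fun p : (I × I) × (I × I) => p.1 ⊔ p.2) ⁻¹' (Iic x ×ˢ Iic y) =
      (Iic x ×ˢ Iic y) ×ˢ (Iic x ×ˢ Iic y) := by
    ext p
    simp only [mem_preimage, mem_prod, mem_Iic, Prod.fst_sup, Prod.snd_sup, sup_le_iff]
    tauto
  rw [map_measureReal_apply hm (measurableSet_Iic.prod measurableSet_Iic), hs,
    measureReal_prod_prod, hμ.2, hν.2]

theorem hasCDF_one : HasCDF (Measure.dirac (0 : I × I)) (fun _ _ => 1) :=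
  ⟨inferInstance, fun x y => by
    rw [measureReal_def, Measure.dirac_apply' _ (measurableSet_Iic.prod measurableSet_Iic),
      indicator_of_mem (show (0 : I × I) ∈ Iic x ×ˢ Iic y from ⟨x.2.1, y.2.1⟩)]
    simp⟩

/-- The quantile function `u ↦ u ^ (1 / p)` of the distribution function `x ↦ x ^ p` on `[0,1]`. -/
def powQuantile (p : ℝ) (u : I) : I :=
  -- For `p = 0` the distribution function is constantly `1`, including `0 ^ 0 = 1`: a point mass at
  -- `0`.
  if h : 0 < p then ⟨(u : ℝ) ^ p⁻¹, Real.rpow_nonneg u.2.1 _,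
    Real.rpow_le_one u.2.1 u.2.2 (inv_nonneg.2 h.le)⟩ else 0

theorem powQuantile_le_iff {p : ℝ} (hp : 0 ≤ p) (u x : I) :
    powQuantile p u ≤ x ↔ (u : ℝ) ≤ (x : ℝ) ^ p := by
  rcases hp.eq_or_lt with rfl | h
  · simp [powQuantile, u.2.2]
  · rw [powQuantile, dif_pos h, ← Subtype.coe_le_coe]
    exact Real.rpow_inv_le_iff_of_pos u.2.1 x.2.1 h

theorem measurable_powQuantile (p : ℝ) : Measurable (powQuantile p) := by
  unfold powQuantile
  split_ifs with h
  · exact Measurable.subtype_mk (by fun_prop)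
  · exact measurable_const

/-- Comonotone coupling: both coordinates are quantile transforms of one uniform variable. -/
theorem exists_hasCDF_min_rpow {p q : ℝ} (hp : 0 ≤ p) (hq : 0 ≤ q) :
    ∃ μ, HasCDF μ (fun x y => min ((x : ℝ) ^ p) ((y : ℝ) ^ q)) := by
  have hm : Measurable fun u => (powQuantile p u, powQuantile q u) :=
    (measurable_powQuantile p).prodMk (measurable_powQuantile q)
  refine ⟨(volume : Measure I).map fun u => (powQuantile p u, powQuantile q u),
    Measure.isProbabilityMeasure_map hm.aemeasurable, fun x y => ?_⟩
  have h0 : 0 ≤ min ((x : ℝ) ^ p) ((y : ℝ) ^ q) :=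
    le_min (Real.rpow_nonneg x.2.1 _) (Real.rpow_nonneg y.2.1 _)
  have hs : (fun u => (powQuantile p u, powQuantile q u)) ⁻¹' (Iic x ×ˢ Iic y) =
      Iic (⟨min ((x : ℝ) ^ p) ((y : ℝ) ^ q), h0,
        min_le_of_left_le (Real.rpow_le_one x.2.1 x.2.2 hp)⟩ : I) := by
    ext u
    simp only [mem_preimage, mem_prod, mem_Iic, powQuantile_le_iff hp, powQuantile_le_iff hq,
      ← Subtype.coe_le_coe, le_min_iff]
  rw [map_measureReal_apply hm (measurableSet_Iic.prod measurableSet_Iic), hs, measureReal_def,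
    volume_Iic, ENNReal.toReal_ofReal h0]

theorem exists_hasCDF_prod_min_rpow {ι : Type*} (s : Finset ι) {p q : ι → ℝ} (hp : ∀ i, 0 ≤ p i)
    (hq : ∀ i, 0 ≤ q i) :
    ∃ μ, HasCDF μ (fun x y => ∏ i ∈ s, min ((x : ℝ) ^ p i) ((y : ℝ) ^ q i)) := by
  classical
  induction s using Finset.induction_on with
  | empty => exact ⟨_, by simpa using hasCDF_one⟩
  | insert i s hi ih =>
    obtain ⟨μ, hμ⟩ := ih
    obtain ⟨ν, hν⟩ := exists_hasCDF_min_rpow (hp i) (hq i)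
    exact ⟨_, by simpa only [Finset.prod_insert hi] using hν.mul hμ⟩

/-- The argument of the Pickands function in `evCopula`. -/
def logRatio (x y : I) : ℝ := Real.log x / Real.log ((x : ℝ) * y)

theorem logRatio_mul {x y : I} (hx : 0 < (x : ℝ)) (hy : 0 < (y : ℝ)) :
    logRatio x y * Real.log ((x : ℝ) * y) = Real.log x ∧
      (1 - logRatio x y) * Real.log ((x : ℝ) * y) = Real.log y := by
  have hl := Real.log_mul hx.ne' hy.ne'
  have h1 := Real.log_nonpos x.2.1 x.2.2
  have h2 := Real.log_nonpos y.2.1 y.2.2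
  have : logRatio x y * Real.log ((x : ℝ) * y) = Real.log x := by
    by_cases h : Real.log ((x : ℝ) * y) = 0
    -- Both logarithms are nonpositive with sum zero, so each vanishes and the junk value of the
    -- quotient is harmless.
    · rw [h, mul_zero]; linarith
    · exact div_mul_cancel₀ _ h
  exact ⟨this, by rw [sub_mul, this, hl]; ring⟩

theorem logRatio_mem (x y : I) : logRatio x y ∈ Icc (0 : ℝ) 1 := by
  have h1 := Real.log_nonpos x.2.1 x.2.2
  have h2 := Real.log_nonpos y.2.1 y.2.2
  rcases x.2.1.eq_or_lt with hx | hx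
  · simp [logRatio, ← hx]
  rcases y.2.1.eq_or_lt with hy | hy
  · simp [logRatio, ← hy]
  have hl := Real.log_mul hx.ne' hy.ne'
  exact ⟨div_nonneg_of_nonpos h1 (by linarith), div_le_one_of_ge (by linarith) (by linarith)⟩

theorem IsPickands.pos {A : ℝ → ℝ} (hA : IsPickands A) {t : ℝ} (ht : t ∈ Icc (0 : ℝ) 1) :
    0 < A t := by
  have := hA.max_le t ht
  rcases le_total t (1 / 2) with h | h
  · linarith [le_max_left (1 - t) t]
  · linarith [le_max_right (1 - t) t]

theorem evCopula_le_evCopula {A B : ℝ → ℝ} (hA : IsPickands A) (hB : IsPickands B)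
    (h : ∀ t ∈ Icc (0 : ℝ) 1, B t ≤ A t) (x y : I) : evCopula A x y ≤ evCopula B x y := by
  have ht := logRatio_mem x y
  change ((x : ℝ) * y) ^ A (logRatio x y) ≤ ((x : ℝ) * y) ^ B (logRatio x y)
  rcases (mul_nonneg x.2.1 y.2.1).eq_or_lt with h0 | h0
  · rw [← h0, Real.zero_rpow (hA.pos ht).ne', Real.zero_rpow (hB.pos ht).ne']
  · exact Real.rpow_le_rpow_of_exponent_ge h0 (mul_le_one₀ x.2.2 y.2.1 y.2.2) (h _ ht)

/-- With `s = log (x * y) ≤ 0` and `t = logRatio x y` one has `log x = t * s` and `log y = (1 - t) *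
s`. Multiplication by `s` turns each max into a min, and `exp` turns the sum into a product. -/
theorem evCopula_eq_prod {ι : Type*} [Fintype ι] {A : ℝ → ℝ} {p q : ι → ℝ}
    (hq : ∀ i, 0 ≤ q i) (hp1 : ∑ i, p i = 1) (hq1 : ∑ i, q i = 1)
    (hA : ∀ t ∈ Icc (0 : ℝ) 1, A t = ∑ i, max (p i * t) (q i * (1 - t))) (x y : I) :
    evCopula A x y = ∏ i, min ((x : ℝ) ^ p i) ((y : ℝ) ^ q i) := by
  have key : ∀ {r : ι → ℝ}, ∑ i, r i = 1 → ∃ i, r i ≠ 0 := fun {r} hr => by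
    by_contra! h
    simp [h] at hr
  have hA0 : A 0 = 1 := by
    rw [hA 0 (by simp)]
    simpa [hq] using hq1
  rcases x.2.1.eq_or_lt with hx | hx
  · obtain ⟨i, hi⟩ := key hp1
    rw [Finset.prod_eq_zero (Finset.mem_univ i)]
    · simp [evCopula, ← hx, hA0]
    · rw [← hx, Real.zero_rpow hi]
      exact min_eq_left (Real.rpow_nonneg y.2.1 _)
  rcases y.2.1.eq_or_lt with hy | hy
  · obtain ⟨i, hi⟩ := key hq1
    rw [Finset.prod_eq_zero (Finset.mem_univ i)]
    · simp [evCopula, ← hy, hA0]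
    · rw [← hy, Real.zero_rpow hi]
      exact min_eq_right (Real.rpow_nonneg x.2.1 _)
  obtain ⟨h1, h2⟩ := logRatio_mul hx hy
  have hl : Real.log ((x : ℝ) * y) ≤ 0 :=
    Real.log_nonpos (mul_nonneg x.2.1 y.2.1) (mul_le_one₀ x.2.2 y.2.1 y.2.2)
  change ((x : ℝ) * y) ^ A (logRatio x y) = _
  rw [Real.rpow_def_of_pos (mul_pos hx hy), hA _ (logRatio_mem x y), Finset.mul_sum,
    Real.exp_sum]
  refine Finset.prod_congr rfl fun i _ => ?_
  rw [Real.rpow_def_of_pos hx, Real.rpow_def_of_pos hy, ← Real.exp_monotone.map_min,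
    ← h1, ← h2, (antitone_mul_left hl).map_max]
  congr 2 <;> ring

/-! ### Symmetry and monotonicity of the integral of one copula against another -/

section

section margins

variable {μ : Measure (I × I)} {C : I → I → ℝ}

theorem HasCDF.apply (hμ : HasCDF μ C) (x y : I) :
    μ (Iic x ×ˢ Iic y) = ENNReal.ofReal (C x y) := by
  have := hμ.1
  rw [← hμ.2, ofReal_measureReal]

theorem HasCDF.nonneg (hμ : HasCDF μ C) (x y : I) : 0 ≤ C x y := by
  rw [← hμ.2]; exact measureReal_nonneg

theorem HasCDF.map_fst (hμ : HasCDF μ C) (h : ∀ x, C x 1 = x) :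
    μ.map Prod.fst = volume := by
  have := hμ.1
  have := Measure.isProbabilityMeasure_map (μ := μ) measurable_fst.aemeasurable
  refine Measure.ext_of_Iic _ _ fun a => ?_
  rw [Measure.map_apply measurable_fst measurableSet_Iic, volume_Iic, ← h a, ← hμ.apply]
  congr 1
  ext p
  simp [Prod.le_def, unitInterval.le_one']

theorem HasCDF.map_snd (hμ : HasCDF μ C) (h : ∀ y, C 1 y = y) :
    μ.map Prod.snd = volume := by
  have := hμ.1
  have := Measure.isProbabilityMeasure_map (μ := μ) measurable_snd.aemeasurable
  refine Measure.ext_of_Iic _ _ fun a => ?_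
  rw [Measure.map_apply measurable_snd measurableSet_Iic, volume_Iic, ← h a, ← hμ.apply]
  congr 1
  ext p
  simp [Prod.le_def, unitInterval.le_one']

theorem HasCDF.measurable (hμ : HasCDF μ C) : Measurable fun p : I × I => C p.1 p.2 := by
  have := hμ.1
  have h : MeasurableSet {z : (I × I) × (I × I) | z.2.1 ≤ z.1.1 ∧ z.2.2 ≤ z.1.2} :=
    (measurableSet_le (by fun_prop) (by fun_prop)).inter
      (measurableSet_le (by fun_prop) (by fun_prop))
  have := (measurable_measure_prodMk_left (ν := μ) h).ennreal_toReal
  convert this using 2 with p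
  rw [← hμ.2]
  rfl

end margins

theorem HasCDF.le_one {μ : Measure (I × I)} {C : I → I → ℝ} (hμ : HasCDF μ C) (x y : I) :
    C x y ≤ 1 := by
  have := hμ.1
  rw [← hμ.2]; exact measureReal_le_one

theorem HasCDF.integrable {μ ν : Measure (I × I)} {C : I → I → ℝ} [IsFiniteMeasure ν]
    (hμ : HasCDF μ C) : Integrable (fun p : I × I => C p.1 p.2) ν :=
  Integrable.of_bound hμ.measurable.aestronglyMeasurable 1 (ae_of_all _ fun p => by
    rw [Real.norm_eq_abs, abs_of_nonneg (hμ.nonneg _ _)]; exact hμ.le_one _ _)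

theorem HasCDF.measureReal_Ici {μ : Measure (I × I)} {C : I → I → ℝ} (hμ : HasCDF μ C)
    (h1 : ∀ x, C x 1 = x) (h2 : ∀ y, C 1 y = y) (x y : I) :
    μ.real (Ici x ×ˢ Ici y) = 1 - x - y + C x y := by
  have := hμ.1
  -- Uniform margins charge no line, so closed and open quadrants have equal mass;
  -- inclusion-exclusion does the rest.
  have e1 : μ (Prod.fst ⁻¹' {x}) = 0 := by
    rw [← Measure.map_apply measurable_fst (measurableSet_singleton x), hμ.map_fst h1]
    simp
  have e2 : μ (Prod.snd ⁻¹' {y}) = 0 := by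
    rw [← Measure.map_apply measurable_snd (measurableSet_singleton y), hμ.map_snd h2]
    simp
  have e3 : (Ici x ×ˢ Ici y : Set (I × I)) =ᵐ[μ] ((Iic x ×ˢ univ ∪ univ ×ˢ Iic y : Set (I × I))ᶜ : Set (I × I)) := by
    have n1 : ∀ᵐ p ∂μ, p.1 ≠ x := by rw [ae_iff]; simpa using! e1
    have n2 : ∀ᵐ p ∂μ, p.2 ≠ y := by rw [ae_iff]; simpa using! e2
    filter_upwards [n1, n2] with p hp1 hp2
    refine propext ?_
    change (x ≤ p.1 ∧ y ≤ p.2) ↔ ¬ ((p.1 ≤ x ∧ True) ∨ (True ∧ p.2 ≤ y))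
    simp only [and_true, true_and, not_or, not_le]
    exact and_congr (by grind) (by grind)
  have hi : (Iic x ×ˢ univ ∩ univ ×ˢ Iic y : Set (I × I)) = Iic x ×ˢ Iic y := by
    ext p; simp [Prod.le_def]
  have m1 : μ.real (Iic x ×ˢ univ) = x := by
    rw [← h1 x, ← hμ.2]; congr 1; ext p; simp [Prod.le_def, unitInterval.le_one']
  have m2 : μ.real (univ ×ˢ Iic y) = y := by
    rw [← h2 y, ← hμ.2]; congr 1; ext p; simp [Prod.le_def, unitInterval.le_one']
  have hu := measureReal_union_add_inter (μ := μ) (s := Iic x ×ˢ univ)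
    (t := univ ×ˢ Iic y) (MeasurableSet.univ.prod measurableSet_Iic)
  rw [hi, m1, m2, hμ.2] at hu
  rw [measureReal_congr e3, probReal_compl_eq_one_sub
    ((measurableSet_Iic.prod MeasurableSet.univ).union (MeasurableSet.univ.prod measurableSet_Iic))]
  linarith

theorem integral_coe_unitInterval : ∫ x : I, (x : ℝ) = 1 / 2 := by
  rw [unitInterval.measurePreserving_coe.integral_comp unitInterval.measurableEmbedding_coe (fun x => x)]
  rw [integral_Icc_eq_integral_Ioc, ← intervalIntegral.integral_of_le zero_le_one]
  simp

/-- The integral of one copula with respect to another is symmetric. -/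
theorem HasCDF.integral_comm {μ ν : Measure (I × I)} {C D : I → I → ℝ} (hμ : HasCDF μ C)
    (hν : HasCDF ν D) (h1 : ∀ x, C x 1 = x) (h2 : ∀ y, C 1 y = y) (h1' : ∀ x, D x 1 = x)
    (h2' : ∀ y, D 1 y = y) :
    ∫ p, C p.1 p.2 ∂ν = ∫ p, D p.1 p.2 ∂μ := by
  have := hμ.1
  have := hν.1
  have hS : MeasurableSet {z : (I × I) × (I × I) | z.2.1 ≤ z.1.1 ∧ z.2.2 ≤ z.1.2} :=
    (measurableSet_le (by fun_prop) (by fun_prop)).inter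
      (measurableSet_le (by fun_prop) (by fun_prop))
  have hν1 : ∫ p, (p.1 : ℝ) ∂ν = 1 / 2 := by
    rw [← integral_coe_unitInterval, ← hν.map_fst h1',
      integral_map measurable_fst.aemeasurable (by fun_prop)]
  have hν2 : ∫ p, (p.2 : ℝ) ∂ν = 1 / 2 := by
    rw [← integral_coe_unitInterval, ← hν.map_snd h2',
      integral_map measurable_snd.aemeasurable (by fun_prop)]
  have hi1 : Integrable (fun p : I × I => (p.1 : ℝ)) ν :=
    Integrable.of_bound (by fun_prop) 1 (ae_of_all _ fun p => by
      rw [Real.norm_eq_abs, abs_of_nonneg p.1.2.1]; exact p.1.2.2)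
  have hi2 : Integrable (fun p : I × I => (p.2 : ℝ)) ν :=
    Integrable.of_bound (by fun_prop) 1 (ae_of_all _ fun p => by
      rw [Real.norm_eq_abs, abs_of_nonneg p.2.2.1]; exact p.2.2.2)
  -- Tonelli on the set of pairs with `q ≤ p`. The integrand on the right is `1 - q.1 - q.2 + C q.1
  -- q.2`, and each coordinate has mean `1/2` under `ν`.
  have key : ∫ p, D p.1 p.2 ∂μ = ∫ q, μ.real (Ici q.1 ×ˢ Ici q.2) ∂ν := by
    have a := Measure.prod_apply (μ := μ) (ν := ν) hS
    have b := Measure.prod_apply_symm (μ := μ) (ν := ν) hS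
    simp_rw [← hν.2, measureReal_def]
    rw [integral_toReal, integral_toReal]
    · congr 1
      exact a.symm.trans b
    · exact (measurable_measure_prodMk_right hS).aemeasurable
    · exact ae_of_all _ fun _ => measure_lt_top _ _
    · exact (measurable_measure_prodMk_left hS).aemeasurable
    · exact ae_of_all _ fun _ => measure_lt_top _ _
  rw [key]
  simp_rw [hμ.measureReal_Ici h1 h2]
  have hi3 : Integrable (fun p : I × I => 1 - (p.1 : ℝ)) ν := (integrable_const _).sub hi1
  have hi4 : Integrable (fun p : I × I => 1 - (p.1 : ℝ) - p.2) ν := hi3.sub hi2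
  rw [integral_add hi4 hμ.integrable, integral_sub hi3 hi2, integral_sub (integrable_const _) hi1,
    hν1, hν2]
  norm_num

theorem HasCDF.integral_mono {μ ν : Measure (I × I)} {C D : I → I → ℝ} (hμ : HasCDF μ C)
    (hν : HasCDF ν D) (h1 : ∀ x, C x 1 = x) (h2 : ∀ y, C 1 y = y) (h1' : ∀ x, D x 1 = x)
    (h2' : ∀ y, D 1 y = y) (h : ∀ x y, C x y ≤ D x y) :
    ∫ p, C p.1 p.2 ∂μ ≤ ∫ p, D p.1 p.2 ∂ν := by
  have := hμ.1
  have := hν.1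
  calc ∫ p, C p.1 p.2 ∂μ ≤ ∫ p, D p.1 p.2 ∂μ :=
        MeasureTheory.integral_mono hμ.integrable hν.integrable fun p => h p.1 p.2
    _ = ∫ p, C p.1 p.2 ∂ν := (hμ.integral_comm hν h1 h2 h1' h2').symm
    _ ≤ ∫ p, D p.1 p.2 ∂ν :=
        MeasureTheory.integral_mono hμ.integrable hν.integrable fun p => h p.1 p.2

end

/-! ### Integration by parts for the integral of a copula against its own measure -/

section

/-- If a measure on the square has uniform first margin and its distribution function has
partial densities `K₁` and `K₂`, then the mean of the distribution function and the integral of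
`K₁ * K₂` add up to the integral of `K₂`. -/
theorem lintegral_measure_Iic_add {μ : Measure (I × I)} [IsProbabilityMeasure μ]
    (hμ : μ.map Prod.fst = volume) {K₁ K₂ : I → I → ENNReal} (hK₁ : Measurable K₁.uncurry)
    (hK₂ : Measurable K₂.uncurry)
    (h₁ : ∀ a b, μ (Iic a ×ˢ Iic b) = ∫⁻ x in Iic a, K₁ x b)
    (h₂ : ∀ a b, μ (Iic a ×ˢ Iic b) = ∫⁻ y in Iio b, K₂ a y) :
    ∫⁻ p, μ (Iic p.1 ×ˢ Iic p.2) ∂μ + ∫⁻ y, ∫⁻ x, K₁ x y * K₂ x y =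
      ∫⁻ y, ∫⁻ x, K₂ x y := by
  have hm : Measurable fun z : (I × I) × I => (Iio z.1.2).indicator (K₂ z.1.1) z.2 := by
    have : (fun z : (I × I) × I => (Iio z.1.2).indicator (K₂ z.1.1) z.2) =
        {z : (I × I) × I | z.2 < z.1.2}.indicator (fun z => K₂.uncurry (z.1.1, z.2)) := by
      ext z
      simp [indicator, Function.uncurry]
    rw [this]
    exact (hK₂.comp (by fun_prop)).indicator (measurableSet_lt (by fun_prop) (by fun_prop))
  have hs1 : ∀ y, Measurable fun x => K₁ x y := fun y => hK₁.comp (by fun_prop : Measurable fun x => (x, y))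
  have hs2 : ∀ y, Measurable fun x => K₂ x y := fun y => hK₂.comp (by fun_prop : Measurable fun x => (x, y))
  have e1 : ∫⁻ p, μ (Iic p.1 ×ˢ Iic p.2) ∂μ =
      ∫⁻ y, ∫⁻ p, (Iio p.2).indicator (K₂ p.1) y ∂μ := by
    rw [← lintegral_lintegral_swap hm.aemeasurable]
    refine lintegral_congr fun p => ?_
    rw [h₂, lintegral_indicator measurableSet_Iio]
  rw [e1, ← lintegral_add_left hm.lintegral_prod_left']
  refine lintegral_congr fun y => ?_
  -- At fixed `y`, `K₁ · y` is the density of the first coordinate on the event `p.2 ≤ y`.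
  -- Integrating `K₂ · y` over this event yields the product term, and over its complement the other
  -- term.
  have hν : (μ.restrict (Prod.snd ⁻¹' Iic y)).map Prod.fst =
      volume.withDensity fun x => K₁ x y := by
    refine Measure.ext_of_Iic _ _ fun a => ?_
    rw [Measure.map_apply measurable_fst measurableSet_Iic,
      Measure.restrict_apply (measurable_fst measurableSet_Iic),
      withDensity_apply _ measurableSet_Iic, ← h₁]
    rfl
  have e2 : ∫⁻ x, K₁ x y * K₂ x y = ∫⁻ p in Prod.snd ⁻¹' Iic y, K₂ p.1 y ∂μ := by
    rw [← lintegral_map (hs2 y) measurable_fst, hν,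
      lintegral_withDensity_eq_lintegral_mul _ (hs1 y) (hs2 y)]
    rfl
  have e3 : ∫⁻ p, (Iio p.2).indicator (K₂ p.1) y ∂μ =
      ∫⁻ p in (Prod.snd ⁻¹' Iic y)ᶜ, K₂ p.1 y ∂μ := by
    rw [← lintegral_indicator (measurable_snd measurableSet_Iic).compl]
    refine lintegral_congr fun p => ?_
    simp [indicator]
  rw [e2, e3, add_comm, lintegral_add_compl _ (measurable_snd measurableSet_Iic),
    ← lintegral_map (hs2 y) measurable_fst, hμ]

/-- The extension of a function on the unit square to the plane, constant outside the square. -/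
def squareExtend (C : I → I → ℝ) (x y : ℝ) : ℝ :=
  C (projIcc 0 1 zero_le_one x) (projIcc 0 1 zero_le_one y)

theorem squareExtend_coe (C : I → I → ℝ) (x y : I) : squareExtend C x y = C x y := by
  simp [squareExtend]

variable {μ : Measure (I × I)} {C : I → I → ℝ}

theorem HasCDF.mono (hμ : HasCDF μ C) {a a' b b' : I} (h : a ≤ a') (h' : b ≤ b') :
    C a b ≤ C a' b' := by
  have := hμ.1
  rw [← hμ.2, ← hμ.2]
  exact measureReal_mono (prod_mono (Iic_subset_Iic.2 h) (Iic_subset_Iic.2 h'))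

theorem HasCDF.sub_le_left (hμ : HasCDF μ C) (h1 : ∀ x, C x 1 = x) {a a' : I} (h : a ≤ a') (b : I) :
    C a' b - C a b ≤ a' - a := by
  have := hμ.1
  -- The increment is the mass of a strip that grows with `c`; at `c = 1` it equals `a' - a`.
  have e : ∀ c : I, C a' c - C a c = μ.real (Ioc a a' ×ˢ Iic c) := fun c => by
    rw [← hμ.2, ← hμ.2, ← measureReal_sdiff (prod_mono (Iic_subset_Iic.2 h) le_rfl)
      (measurableSet_Iic.prod measurableSet_Iic), ← Iic_sdiff_Iic]
    congr 1
    ext p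
    simp only [mem_sdiff, mem_prod, mem_Iic]
    tauto
  rw [← h1 a', ← h1 a, e, e]
  exact measureReal_mono (prod_mono le_rfl (Iic_subset_Iic.2 b.2.2))

theorem HasCDF.swap (hμ : HasCDF μ C) : HasCDF (μ.map Prod.swap) (fun x y => C y x) := by
  have := hμ.1
  refine ⟨Measure.isProbabilityMeasure_map measurable_swap.aemeasurable, fun x y => ?_⟩
  change _ = C y x
  rw [map_measureReal_apply measurable_swap (measurableSet_Iic.prod measurableSet_Iic), ← hμ.2]
  congr 1
  ext p
  simp [Prod.le_def, and_comm]

theorem HasCDF.lipschitzWith_left (hμ : HasCDF μ C) (h1 : ∀ x, C x 1 = x) (y : ℝ) :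
    LipschitzWith 1 fun x => squareExtend C x y := by
  refine LipschitzWith.of_le_add fun x x' => ?_
  rw [squareExtend, squareExtend]
  set b := projIcc (0 : ℝ) 1 zero_le_one y
  have hp := (LipschitzWith.projIcc (zero_le_one (α := ℝ))).dist_le_mul x x'
  rw [NNReal.coe_one, one_mul, Subtype.dist_eq, Real.dist_eq] at hp
  rcases le_total (projIcc (0 : ℝ) 1 zero_le_one x) (projIcc (0 : ℝ) 1 zero_le_one x') with h | h
  · linarith [hμ.mono h (le_refl b), dist_nonneg (x := x) (y := x')]
  · linarith [hμ.sub_le_left h1 h b, le_abs_self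
      ((projIcc (0 : ℝ) 1 zero_le_one x : ℝ) - projIcc (0 : ℝ) 1 zero_le_one x')]

theorem HasCDF.monotone_left (hμ : HasCDF μ C) (y : ℝ) :
    Monotone fun x => squareExtend C x y :=
  fun _ _ h => hμ.mono (monotone_projIcc zero_le_one h) le_rfl

theorem HasCDF.zero_left (hμ : HasCDF μ C) (h1 : ∀ x, C x 1 = x) (y : I) : C 0 y = 0 :=
  le_antisymm ((hμ.mono le_rfl y.2.2).trans_eq (h1 0)) (hμ.nonneg _ _)

theorem HasCDF.continuous_squareExtend (hμ : HasCDF μ C) (h1 : ∀ x, C x 1 = x)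
    (h2 : ∀ y, C 1 y = y) : Continuous (squareExtend C).uncurry :=
  (LipschitzWith.uncurry (hμ.lipschitzWith_left h1)
    (hμ.swap.lipschitzWith_left (C := fun x y => C y x) h2)).continuous

theorem HasCDF.deriv_left_nonneg (hμ : HasCDF μ C) (x y : ℝ) :
    0 ≤ deriv (fun z => squareExtend C z y) x :=
  (hμ.monotone_left y).deriv_nonneg

theorem HasCDF.deriv_left_le_one (hμ : HasCDF μ C) (h1 : ∀ x, C x 1 = x) (x y : ℝ) :
    deriv (fun z => squareExtend C z y) x ≤ 1 :=
  (le_abs_self _).trans (norm_deriv_le_of_lipschitz (hμ.lipschitzWith_left h1 y))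

theorem HasCDF.measurable_deriv_left (hμ : HasCDF μ C) (h1 : ∀ x, C x 1 = x)
    (h2 : ∀ y, C 1 y = y) :
    Measurable fun p : ℝ × ℝ => deriv (fun z => squareExtend C z p.2) p.1 :=
  (measurable_deriv_with_param (f := fun y x => squareExtend C x y)
    ((hμ.continuous_squareExtend h1 h2).comp continuous_swap)).comp measurable_swap

theorem setLIntegral_Iic_unitInterval (f : ℝ → ENNReal) (a : I) :
    ∫⁻ x in Iic a, f x = ∫⁻ x in Ioc (0 : ℝ) a, f x := by
  have hi : (Subtype.val '' (Iic a) : Set ℝ) = Icc 0 (a : ℝ) := by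
    ext x
    simp only [mem_image, mem_Iic, Subtype.exists, mem_Icc]
    exact ⟨fun ⟨y, hy, h, e⟩ => e ▸ ⟨hy.1, h⟩, fun h => ⟨x, ⟨h.1, h.2.trans a.2.2⟩, h.2, rfl⟩⟩
  have h := (unitInterval.measurePreserving_coe.restrict_image_emb
    unitInterval.measurableEmbedding_coe (Iic a)).lintegral_comp_emb
      unitInterval.measurableEmbedding_coe f
  rw [h, hi, Measure.restrict_restrict measurableSet_Icc, inter_eq_left.2
    (Icc_subset_Icc le_rfl a.2.2), Measure.restrict_congr_set Ioc_ae_eq_Icc]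

/-- Sections of a copula are Lipschitz, hence absolutely continuous, so the fundamental theorem of
calculus applies. -/
theorem HasCDF.apply_eq_lintegral_deriv (hμ : HasCDF μ C) (h1 : ∀ x, C x 1 = x) (a b : I) :
    μ (Iic a ×ˢ Iic b) =
      ∫⁻ x in Iic a, ENNReal.ofReal (deriv (fun z => squareExtend C z b) x) := by
  have hac := (hμ.lipschitzWith_left h1 b).lipschitzOnWith (s := uIcc 0 (a : ℝ))
    |>.absolutelyContinuousOnInterval
  have hi := hac.integral_deriv_eq_sub
  rw [intervalIntegral.integral_of_le a.2.1] at hi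
  rw [setLIntegral_Iic_unitInterval (fun x => ENNReal.ofReal (deriv (fun z => squareExtend C z b) x)),
    ← ofReal_integral_eq_lintegral_ofReal, hi, hμ.apply, squareExtend_coe]
  · have := squareExtend_coe C 0 b
    rw [Icc.coe_zero] at this
    rw [this, hμ.zero_left h1, sub_zero]
  · exact (intervalIntegrable_iff_integrableOn_Ioc_of_le a.2.1).1 hac.intervalIntegrable_deriv
  · exact ae_of_all _ fun x => hμ.deriv_left_nonneg x b

end

section

variable {μ : Measure (I × I)} {C : I → I → ℝ}

theorem integral_unitInterval (f : ℝ → ℝ) : ∫ x : I, f x = ∫ x in (0 : ℝ)..1, f x := by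
  rw [unitInterval.measurePreserving_coe.integral_comp unitInterval.measurableEmbedding_coe f,
    integral_Icc_eq_integral_Ioc, ← intervalIntegral.integral_of_le zero_le_one]

theorem setLIntegral_univ_unitInterval_ofReal {f : I → ℝ} (hf : Measurable f)
    (h0 : ∀ x, 0 ≤ f x) (h1 : ∀ x, f x ≤ 1) :
    ∫⁻ x, ENNReal.ofReal (f x) = ENNReal.ofReal (∫ x, f x) := by
  rw [ofReal_integral_eq_lintegral_ofReal _ (ae_of_all _ h0)]
  exact Integrable.of_bound hf.aestronglyMeasurable 1 (ae_of_all _ fun x => by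
    rw [Real.norm_eq_abs, abs_of_nonneg (h0 x)]; exact h1 x)

theorem HasCDF.integral_eq_half_sub (hμ : HasCDF μ C) (h1 : ∀ x, C x 1 = x)
    (h2 : ∀ y, C 1 y = y) :
    ∫ p, C p.1 p.2 ∂μ = 1 / 2 - ∫ x in (0 : ℝ)..1, ∫ y in (0 : ℝ)..1,
      deriv (fun z => squareExtend C z y) x * deriv (fun z => squareExtend C x z) y := by
  have := hμ.1
  set k₁ : ℝ → ℝ → ℝ := fun x y => deriv (fun z => squareExtend C z y) x with hk₁
  set k₂ : ℝ → ℝ → ℝ := fun x y => deriv (fun z => squareExtend C x z) y with hk₂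
  have m1 : Measurable fun p : ℝ × ℝ => k₁ p.1 p.2 := hμ.measurable_deriv_left h1 h2
  have m2 : Measurable fun p : ℝ × ℝ => k₂ p.1 p.2 :=
    (hμ.swap.measurable_deriv_left (C := fun x y => C y x) h2 h1).comp measurable_swap
  have n1 : ∀ x y, 0 ≤ k₁ x y := fun x y => hμ.deriv_left_nonneg x y
  have n2 : ∀ x y, 0 ≤ k₂ x y := fun x y => hμ.swap.deriv_left_nonneg y x
  have l1 : ∀ x y, k₁ x y ≤ 1 := fun x y => hμ.deriv_left_le_one h1 x y
  have l2 : ∀ x y, k₂ x y ≤ 1 := fun x y =>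
    hμ.swap.deriv_left_le_one (C := fun x y => C y x) h2 y x
  have c1 : Measurable fun p : I × I => k₁ p.1 p.2 :=
    m1.comp (by fun_prop : Measurable fun p : I × I => ((p.1 : ℝ), (p.2 : ℝ)))
  have c2 : Measurable fun p : I × I => k₂ p.1 p.2 :=
    m2.comp (by fun_prop : Measurable fun p : I × I => ((p.1 : ℝ), (p.2 : ℝ)))
  have hA₂ : ∀ a b : I, μ (Iic a ×ˢ Iic b) = ∫⁻ y in Iio b, ENNReal.ofReal (k₂ a y) := by
    intro a b
    have h := hμ.swap.apply_eq_lintegral_deriv (C := fun x y => C y x) h2 b a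
    rw [Measure.map_apply measurable_swap (measurableSet_Iic.prod measurableSet_Iic),
      preimage_swap_prod] at h
    rw [h, Measure.restrict_congr_set Iio_ae_eq_Iic]
    rfl
  have key := lintegral_measure_Iic_add (hμ.map_fst h1)
    (K₁ := fun x y => ENNReal.ofReal (k₁ x y)) (K₂ := fun x y => ENNReal.ofReal (k₂ x y))
    c1.ennreal_ofReal c2.ennreal_ofReal (fun a b => hμ.apply_eq_lintegral_deriv h1 a b) hA₂
  have hC : ∫⁻ p, μ (Iic p.1 ×ˢ Iic p.2) ∂μ = ENNReal.ofReal (∫ p, C p.1 p.2 ∂μ) := by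
    rw [ofReal_integral_eq_lintegral_ofReal hμ.integrable (ae_of_all _ fun p => hμ.nonneg _ _)]
    exact lintegral_congr fun p => hμ.apply _ _
  -- Integrating `∂₂C` in `y` first gives `C x 1 = x`, whose mean is `1/2`.
  have hR : ∫⁻ y : I, ∫⁻ x : I, ENNReal.ofReal (k₂ x y) = ENNReal.ofReal (1 / 2) := by
    rw [← lintegral_lintegral_swap c2.ennreal_ofReal.aemeasurable, ← integral_coe_unitInterval,
      ← setLIntegral_univ_unitInterval_ofReal (by fun_prop) (fun x => x.2.1) (fun x => x.2.2)]
    refine lintegral_congr fun x => ?_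
    have := hA₂ x 1
    rw [hμ.apply, h1, Measure.restrict_congr_set Iio_ae_eq_Iic] at this
    rw [this, ← setLIntegral_univ]
    congr 2
    ext y
    simp [unitInterval.le_one']
  have mk : Measurable fun p : I × I => k₁ p.1 p.2 * k₂ p.1 p.2 := c1.mul c2
  have hk0 : ∀ x y, 0 ≤ k₁ x y * k₂ x y := fun x y => mul_nonneg (n1 x y) (n2 x y)
  have hk1 : ∀ x y, k₁ x y * k₂ x y ≤ 1 := fun x y => mul_le_one₀ (l1 x y) (n2 x y) (l2 x y)
  have hP : ∫⁻ y : I, ∫⁻ x : I, ENNReal.ofReal (k₁ x y) * ENNReal.ofReal (k₂ x y) =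
      ENNReal.ofReal (∫ x : I, ∫ y : I, k₁ x y * k₂ x y) := by
    simp_rw [← ENNReal.ofReal_mul (n1 _ _)]
    rw [← lintegral_lintegral_swap mk.ennreal_ofReal.aemeasurable,
      ← setLIntegral_univ_unitInterval_ofReal]
    · refine lintegral_congr fun x => ?_
      exact setLIntegral_univ_unitInterval_ofReal
        (mk.comp (measurable_const.prodMk measurable_id)) (fun y => hk0 x y) (fun y => hk1 x y)
    · exact (mk.stronglyMeasurable.integral_prod_right' (ν := volume)).measurable
    · exact fun x => integral_nonneg fun y => hk0 x y
    · intro x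
      calc ∫ y : I, k₁ x y * k₂ x y ≤ ∫ y : I, (1 : ℝ) :=
            integral_mono_of_nonneg (ae_of_all _ fun y => hk0 x y) (integrable_const _)
              (ae_of_all _ fun y => hk1 x y)
        _ = 1 := by simp
  have h0 : 0 ≤ ∫ x : I, ∫ y : I, k₁ x y * k₂ x y :=
    integral_nonneg fun x => integral_nonneg fun y => hk0 x y
  rw [hC, hP, hR, ← ENNReal.ofReal_add (integral_nonneg fun p => hμ.nonneg _ _) h0,
    ENNReal.ofReal_eq_ofReal_iff
      (add_nonneg (integral_nonneg fun p => hμ.nonneg _ _) h0) (by norm_num)] at key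
  have e : ∫ x : I, ∫ y : I, k₁ x y * k₂ x y =
      ∫ x in (0 : ℝ)..1, ∫ y in (0 : ℝ)..1, k₁ x y * k₂ x y := by
    rw [← integral_unitInterval]
    exact integral_congr_ae (ae_of_all _ fun x => integral_unitInterval fun y => k₁ x y * k₂ x y)
  rw [← e]
  linarith

end

/-! ### The derivative integral for piecewise monomial functions -/

theorem deriv_mul_deriv_of_eqOn_rpow {F : ℝ → ℝ → ℝ} {U : Set (ℝ × ℝ)} (hU : IsOpen U) {a b : ℝ}
    (hF : ∀ x y, (x, y) ∈ U → F x y = x ^ a * y ^ b) {x y : ℝ} (hx : 0 < x) (hy : 0 < y)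
    (h : (x, y) ∈ U) :
    deriv (fun z => F z y) x * deriv (fun z => F x z) y =
      a * b * x ^ (2 * a - 1) * y ^ (2 * b - 1) := by
  have e1 : (fun z => F z y) =ᶠ[nhds x] fun z => z ^ a * y ^ b := by
    have : Continuous fun z : ℝ => (z, y) := by fun_prop
    filter_upwards [this.continuousAt.preimage_mem_nhds (hU.mem_nhds h)] with z hz
    exact hF z y hz
  have e2 : (fun z => F x z) =ᶠ[nhds y] fun z => x ^ a * z ^ b := by
    have : Continuous fun z : ℝ => (x, z) := by fun_prop
    filter_upwards [this.continuousAt.preimage_mem_nhds (hU.mem_nhds h)] with z hz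
    exact hF x z hz
  rw [e1.deriv_eq, e2.deriv_eq,
    ((Real.hasDerivAt_rpow_const (Or.inl hx.ne')).mul_const (y ^ b)).deriv,
    ((Real.hasDerivAt_rpow_const (Or.inl hy.ne')).const_mul (x ^ a)).deriv,
    show 2 * a - 1 = (a - 1) + a by ring, show 2 * b - 1 = b + (b - 1) by ring,
    Real.rpow_add hx, Real.rpow_add hy]
  ring

/-- The factor `b` is kept inside the integrand so that it vanishes at `b = 0`, where `y ^ (-1)`
alone would not be integrable at `0`. -/
theorem intervalIntegrable_mul_rpow {b : ℝ} (hb : 0 ≤ b) (c u v : ℝ) :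
    IntervalIntegrable (fun y => c * b * y ^ (2 * b - 1)) volume u v := by
  rcases hb.eq_or_lt with rfl | hb
  · simp
  · exact (intervalIntegral.intervalIntegrable_rpow' (by linarith)).const_mul _

theorem integral_mul_rpow {b : ℝ} (hb : 0 ≤ b) (c u v : ℝ) :
    ∫ y in u..v, c * b * y ^ (2 * b - 1) = c / 2 * (v ^ (2 * b) - u ^ (2 * b)) := by
  rcases hb.eq_or_lt with rfl | hb
  · simp
  · rw [intervalIntegral.integral_const_mul, integral_rpow (Or.inl (by linarith)), sub_add_cancel]
    field_simp

theorem integral_piecewise {g g₀ g₁ g₂ : ℝ → ℝ} {u v : ℝ} (hu : 0 ≤ u) (huv : u ≤ v) (hv : v ≤ 1)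
    (h₀ : EqOn g₀ g (Ioo 0 u)) (h₁ : EqOn g₁ g (Ioo u v)) (h₂ : EqOn g₂ g (Ioo v 1))
    (i₀ : IntervalIntegrable g₀ volume 0 u) (i₁ : IntervalIntegrable g₁ volume u v)
    (i₂ : IntervalIntegrable g₂ volume v 1) :
    ∫ y in (0 : ℝ)..1, g y =
      (∫ y in (0 : ℝ)..u, g₀ y) + (∫ y in u..v, g₁ y) + ∫ y in v..1, g₂ y := by
  rw [intervalIntegral.integral_congr_Ioo_of_le hu h₀,
    intervalIntegral.integral_congr_Ioo_of_le huv h₁,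
    intervalIntegral.integral_congr_Ioo_of_le hv h₂]
  rw [← uIoo_of_le hu] at h₀
  rw [← uIoo_of_le huv] at h₁
  rw [← uIoo_of_le hv] at h₂
  have j₀ := i₀.congr_uIoo h₀
  have j₁ := i₁.congr_uIoo h₁
  rw [intervalIntegral.integral_add_adjacent_intervals j₀ j₁,
    intervalIntegral.integral_add_adjacent_intervals (j₀.trans j₁) (i₂.congr_uIoo h₂)]

/-- The mean of `∂₁F ∂₂F` over the unit square for a function `F` that equals a monomial on each of
three regions separated by the curves `y = x ^ k₁` and `y = x ^ k₂`. -/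
theorem integral_deriv_mul_deriv_of_wedges {F : ℝ → ℝ → ℝ} {a₀ a₁ b₁ b₂ k₁ k₂ : ℝ}
    (hb₁ : 0 ≤ b₁) (hb₂ : 0 ≤ b₂) (hk₂ : 0 ≤ k₂) (hk : k₂ ≤ k₁)
    (p₀ : 0 < a₀ + k₁) (p₁ : 0 < a₁ + k₁ * b₁) (p₂ : 0 < a₁ + k₂ * b₁)
    (h₀ : ∀ x ∈ Ioo (0 : ℝ) 1, ∀ y ∈ Ioo (0 : ℝ) 1, y < x ^ k₁ → F x y = x ^ a₀ * y)
    (h₁ : ∀ x ∈ Ioo (0 : ℝ) 1, ∀ y ∈ Ioo (0 : ℝ) 1, x ^ k₁ < y → y < x ^ k₂ →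
      F x y = x ^ a₁ * y ^ b₁)
    (h₂ : ∀ x ∈ Ioo (0 : ℝ) 1, ∀ y ∈ Ioo (0 : ℝ) 1, x ^ k₂ < y → F x y = x * y ^ b₂) :
    ∫ x in (0 : ℝ)..1, ∫ y in (0 : ℝ)..1, deriv (fun z => F z y) x * deriv (fun z => F x z) y =
      1 / 4 * (a₀ / (a₀ + k₁) + (a₁ / (a₁ + k₂ * b₁) - a₁ / (a₁ + k₁ * b₁)) +
        (1 - 1 / (1 + k₂ * b₂))) := by
  have c₁ : Continuous fun p : ℝ × ℝ => p.1 ^ k₁ :=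
    (Real.continuous_rpow_const (hk₂.trans hk)).comp continuous_fst
  have c₂ : Continuous fun p : ℝ × ℝ => p.1 ^ k₂ :=
    (Real.continuous_rpow_const hk₂).comp continuous_fst
  have o : IsOpen (Ioo (0 : ℝ) 1 ×ˢ Ioo (0 : ℝ) 1) := isOpen_Ioo.prod isOpen_Ioo
  have inner : ∀ x ∈ Ioo (0 : ℝ) 1,
      ∫ y in (0 : ℝ)..1, deriv (fun z => F z y) x * deriv (fun z => F x z) y =
        a₀ / 2 * x ^ (2 * (a₀ + k₁) - 1) + (a₁ / 2 * x ^ (2 * (a₁ + k₂ * b₁) - 1) -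
          a₁ / 2 * x ^ (2 * (a₁ + k₁ * b₁) - 1)) +
          (1 / 2 * x - 1 / 2 * x ^ (2 * (1 + k₂ * b₂) - 1)) := by
    intro x hx
    have hx0 := hx.1
    have u0 : 0 < x ^ k₁ := Real.rpow_pos_of_pos hx0 _
    have v0 : 0 < x ^ k₂ := Real.rpow_pos_of_pos hx0 _
    have uv : x ^ k₁ ≤ x ^ k₂ := Real.rpow_le_rpow_of_exponent_ge hx0 hx.2.le hk
    have v1 : x ^ k₂ ≤ 1 := Real.rpow_le_one hx0.le hx.2.le hk₂
    rw [integral_piecewise u0.le uv v1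
      (g₀ := fun y => a₀ * x ^ (2 * a₀ - 1) * 1 * y ^ (2 * (1 : ℝ) - 1))
      (g₁ := fun y => a₁ * x ^ (2 * a₁ - 1) * b₁ * y ^ (2 * b₁ - 1))
      (g₂ := fun y => 1 * x ^ (2 * (1 : ℝ) - 1) * b₂ * y ^ (2 * b₂ - 1)) ?_ ?_ ?_
      (intervalIntegrable_mul_rpow zero_le_one _ _ _) (intervalIntegrable_mul_rpow hb₁ _ _ _)
      (intervalIntegrable_mul_rpow hb₂ _ _ _), integral_mul_rpow zero_le_one,
      integral_mul_rpow hb₁, integral_mul_rpow hb₂]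
    -- The limits of integration are `y = x ^ k`, which merges the two powers into a single power of
    -- `x`.
    · have e : ∀ a k b : ℝ, x ^ (2 * (a + k * b) - 1) = x ^ (2 * a - 1) * (x ^ k) ^ (2 * b) :=
        fun a k b => by
          rw [← Real.rpow_mul hx0.le, ← Real.rpow_add hx0]
          congr 1
          ring
      have e0 := e a₀ k₁ 1
      rw [mul_one] at e0
      rw [e0, e, e, e, Real.one_rpow, Real.zero_rpow (by norm_num),
        mul_one, show (2 : ℝ) - 1 = 1 by norm_num, Real.rpow_one]
      ring
    · intro y hy
      have hy1 : y < 1 := hy.2.trans_le (uv.trans v1)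
      have := deriv_mul_deriv_of_eqOn_rpow (F := F) (a := a₀) (b := 1)
        (o.inter (isOpen_lt continuous_snd c₁))
        (fun x y h => by rw [Real.rpow_one]; exact h₀ x h.1.1 y h.1.2 h.2) hx0 hy.1
        ⟨⟨hx, hy.1, hy1⟩, hy.2⟩
      simp only [this]
      ring
    · intro y hy
      have hy0 : 0 < y := u0.trans hy.1
      have := deriv_mul_deriv_of_eqOn_rpow (F := F) (a := a₁) (b := b₁)
        (o.inter ((isOpen_lt c₁ continuous_snd).inter (isOpen_lt continuous_snd c₂)))
        (fun x y h => h₁ x h.1.1 y h.1.2 h.2.1 h.2.2) hx0 hy0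
        ⟨⟨hx, hy0, hy.2.trans_le v1⟩, hy⟩
      simp only [this]
      ring
    · intro y hy
      have hy0 : 0 < y := v0.trans hy.1
      have := deriv_mul_deriv_of_eqOn_rpow (F := F) (a := 1) (b := b₂)
        (o.inter (isOpen_lt c₂ continuous_snd))
        (fun x y h => by rw [Real.rpow_one]; exact h₂ x h.1.1 y h.1.2 h.2) hx0 hy0
        ⟨⟨hx, hy0, hy.2⟩, hy.1⟩
      simp only [this]
      ring
  have p₃ : 0 < 1 + k₂ * b₂ := by positivity
  have ii : ∀ {c e : ℝ}, 0 < e → IntervalIntegrable (fun x : ℝ => c * x ^ (2 * e - 1)) volume 0 1 :=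
    fun he => (intervalIntegral.intervalIntegrable_rpow' (by linarith)).const_mul _
  have iv : ∀ {c e : ℝ}, 0 < e → ∫ x in (0 : ℝ)..1, c / 2 * x ^ (2 * e - 1) = 1 / 4 * (c / e) := by
    intro c e he
    rw [intervalIntegral.integral_const_mul, integral_rpow (Or.inl (by linarith)), sub_add_cancel,
      Real.one_rpow, Real.zero_rpow (by positivity)]
    field_simp
    norm_num
  have ix : IntervalIntegrable (fun x : ℝ => 1 / 2 * x) volume 0 1 :=
    (continuous_const.mul continuous_id).intervalIntegrable _ _
  rw [intervalIntegral.integral_congr_Ioo_of_le zero_le_one inner,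
    intervalIntegral.integral_add ((ii p₀).add ((ii p₂).sub (ii p₁))) (ix.sub (ii p₃)),
    intervalIntegral.integral_add (ii p₀) ((ii p₂).sub (ii p₁)),
    intervalIntegral.integral_sub (ii p₂) (ii p₁), intervalIntegral.integral_sub ix (ii p₃),
    iv p₀, iv p₁, iv p₂, iv p₃, intervalIntegral.integral_const_mul, integral_id]
  ring

/-! ### Kendall's tau of tents and of three-line maxima -/

section

theorem HasCDF.kendallTau_eq {μ : Measure (I × I)} {C : I → I → ℝ} (hμ : HasCDF μ C) :
    kendallTau C = 4 * ∫ p, C p.1 p.2 ∂μ - 1 := by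
  rw [kendallTau, hμ.copulaMeasure_eq]

theorem isPickands_of_eq_sum {ι : Type*} [Fintype ι] {A : ℝ → ℝ} {p q : ι → ℝ}
    (hp : ∀ i, 0 ≤ p i) (hq : ∀ i, 0 ≤ q i) (hp1 : ∑ i, p i = 1) (hq1 : ∑ i, q i = 1)
    (hA : ∀ t ∈ Icc (0 : ℝ) 1, A t = ∑ i, max (p i * t) (q i * (1 - t))) : IsPickands A where
  convexOn := by
    have h : ConvexOn ℝ (Icc (0 : ℝ) 1) fun t => ∑ i, max (p i * t) (q i * (1 - t)) := by
      refine ⟨convex_Icc 0 1, fun x _ y _ a b ha hb hab => ?_⟩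
      simp only [smul_eq_mul, Finset.mul_sum, ← Finset.sum_add_distrib]
      refine Finset.sum_le_sum fun i _ => max_le ?_ ?_
      · nlinarith [mul_le_mul_of_nonneg_left (le_max_left (p i * x) (q i * (1 - x))) ha,
          mul_le_mul_of_nonneg_left (le_max_left (p i * y) (q i * (1 - y))) hb]
      · have e : q i * (1 - (a * x + b * y)) = a * (q i * (1 - x)) + b * (q i * (1 - y)) := by
          linear_combination (-(q i)) * hab
        rw [e]
        exact add_le_add (mul_le_mul_of_nonneg_left (le_max_right _ _) ha)
          (mul_le_mul_of_nonneg_left (le_max_right _ _) hb)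
    exact h.congr fun t ht => (hA t ht).symm
  max_le t ht := by
    rw [hA t ht]
    refine max_le ?_ ?_
    · calc 1 - t = ∑ i, q i * (1 - t) := by rw [← Finset.sum_mul, hq1, one_mul]
        _ ≤ _ := Finset.sum_le_sum fun i _ => le_max_right _ _
    · calc t = ∑ i, p i * t := by rw [← Finset.sum_mul, hp1, one_mul]
        _ ≤ _ := Finset.sum_le_sum fun i _ => le_max_left _ _
  le_one t ht := by
    rw [hA t ht]
    calc ∑ i, max (p i * t) (q i * (1 - t)) ≤ ∑ i, (p i * t + q i * (1 - t)) :=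
          Finset.sum_le_sum fun i _ =>
            max_le_add_of_nonneg (mul_nonneg (hp i) ht.1) (mul_nonneg (hq i) (sub_nonneg.2 ht.2))
      _ = 1 := by rw [Finset.sum_add_distrib, ← Finset.sum_mul, ← Finset.sum_mul, hp1, hq1]; ring

theorem squareExtend_of_mem (C : I → I → ℝ) {x y : ℝ} (hx : x ∈ Ioo (0 : ℝ) 1)
    (hy : y ∈ Ioo (0 : ℝ) 1) :
    squareExtend C x y = C ⟨x, Ioo_subset_Icc_self hx⟩ ⟨y, Ioo_subset_Icc_self hy⟩ := by
  rw [squareExtend, projIcc_of_mem _ (Ioo_subset_Icc_self hx),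
    projIcc_of_mem _ (Ioo_subset_Icc_self hy)]

section tent

variable {c y : ℝ}

theorem tentT_eq_max (h0 : 0 < c) (h1 : c < 1) (hy : y ≤ 1) (t : ℝ) :
    tentT c y t = max (1 - (1 - y) / c * t) (1 - (1 - y) / (1 - c) * (1 - t)) := by
  have h1' : 0 < 1 - c := sub_pos.2 h1
  have hd : 0 ≤ (1 - y) / (c * (1 - c)) := div_nonneg (by linarith) (by positivity)
  have e : (1 - y) / (1 - c) * (1 - t) - (1 - y) / c * t = (1 - y) / (c * (1 - c)) * (c - t) := by
    field_simp
    ring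
  rw [tentT]
  split_ifs with h
  · rw [max_eq_left (by nlinarith [mul_nonneg hd (sub_nonneg.2 h)])]
    ring
  · rw [max_eq_right (by nlinarith [mul_nonneg hd (sub_nonneg.2 (not_le.1 h).le)])]
    ring

/-- Two summands are linear and only the third has a kink, at `t = c`, where both of its branches
equal `1 - y`. -/
theorem tentT_eq_sum (h0 : 0 < c) (h1 : c < 1) (hy : y ≤ 1) {t : ℝ} (ht : t ∈ Icc (0 : ℝ) 1)
    (hm : (1 - y) / c ≤ 1) (hn : (1 - y) / (1 - c) ≤ 1) :
    tentT c y t = ∑ i : Fin 3, max (![1 - (1 - y) / c, 0, (1 - y) / c] i * t)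
      (![0, 1 - (1 - y) / (1 - c), (1 - y) / (1 - c)] i * (1 - t)) := by
  have ha := mul_nonneg (sub_nonneg.2 hm) ht.1
  have hb := mul_nonneg (sub_nonneg.2 hn) (sub_nonneg.2 ht.2)
  rw [tentT_eq_max h0 h1 hy, Fin.sum_univ_three]
  simp only [Matrix.cons_val_zero, Matrix.cons_val_one, Matrix.cons_val, zero_mul]
  rw [max_eq_left ha, max_eq_right hb, ← max_add_add_left, max_comm]
  congr 1 <;> ring

theorem tent_weights (h0 : 0 < c) (h1 : c < 1) (hc : c ≤ y) (hc' : 1 - c ≤ y) (hy : y ≤ 1) :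
    0 ≤ (1 - y) / c ∧ (1 - y) / c ≤ 1 ∧ 0 ≤ (1 - y) / (1 - c) ∧ (1 - y) / (1 - c) ≤ 1 :=
  ⟨div_nonneg (by linarith) (by linarith), (div_le_one h0).2 (by linarith),
    div_nonneg (by linarith) (by linarith), (div_le_one (by linarith)).2 (by linarith)⟩

theorem isPickands_tentT (h0 : 0 < c) (h1 : c < 1) (hc : c ≤ y) (hc' : 1 - c ≤ y) (hy : y ≤ 1) :
    IsPickands (tentT c y) := by
  obtain ⟨m0, m1, n0, n1⟩ := tent_weights h0 h1 hc hc' hy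
  refine isPickands_of_eq_sum ?_ ?_ ?_ ?_ fun t ht => tentT_eq_sum h0 h1 hy ht m1 n1
  · intro i; fin_cases i <;> simp [m0, m1]
  · intro i; fin_cases i <;> simp [n0, n1]
  · simp [Fin.sum_univ_three]
  · simp [Fin.sum_univ_three]

theorem kendallTau_tentT (h0 : 0 < c) (h1 : c < 1) (hc : c ≤ y) (hc' : 1 - c ≤ y)
    (hy : y ≤ 1) :
    kendallTau (evCopula (tentT c y)) = (1 - y) / y := by
  obtain ⟨m0, m1, n0, n1⟩ := tent_weights h0 h1 hc hc' hy
  have hP := isPickands_tentT h0 h1 hc hc' hy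
  have hm : (1 - y) / c = (1 - c) / c * ((1 - y) / (1 - c)) := by
    have : 1 - c ≠ 0 := by linarith
    field_simp
  have hsum := fun t (ht : t ∈ Icc (0 : ℝ) 1) => tentT_eq_sum h0 h1 hy ht m1 n1
  have hk : 0 < (1 - c) / c := div_pos (by linarith) h0
  have hval : 1 - (1 - y) / c + (1 - c) / c = y / c := by field_simp; ring
  set m := (1 - y) / c with hm_def
  set n := (1 - y) / (1 - c)
  set k := (1 - c) / c
  have hp : ∀ i, 0 ≤ (![1 - m, 0, m] : Fin 3 → ℝ) i := by
    intro i; fin_cases i <;> simp [m0, m1]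
  have hq : ∀ i, 0 ≤ (![0, 1 - n, n] : Fin 3 → ℝ) i := by
    intro i; fin_cases i <;> simp [n0, n1]
  have hC : ∀ x z : I, evCopula (tentT c y) x z =
      (x : ℝ) ^ (1 - m) * (z : ℝ) ^ (1 - n) * min ((x : ℝ) ^ m) ((z : ℝ) ^ n) := by
    intro x z
    rw [evCopula_eq_prod hq (by simp [Fin.sum_univ_three]) (by simp [Fin.sum_univ_three]) hsum,
      Fin.prod_univ_three]
    simp only [Matrix.cons_val_zero, Matrix.cons_val_one, Matrix.cons_val, Real.rpow_zero]
    rw [min_eq_left (Real.rpow_le_one x.2.1 x.2.2 (sub_nonneg.2 m1)),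
      min_eq_right (Real.rpow_le_one z.2.1 z.2.2 (sub_nonneg.2 n1))]
  obtain ⟨μ, hμ⟩ := exists_hasCDF_prod_min_rpow Finset.univ hp hq
  have hμ' : HasCDF μ (evCopula (tentT c y)) :=
    ⟨hμ.1, fun x z => by
      rw [hμ.2, evCopula_eq_prod hq (by simp [Fin.sum_univ_three]) (by simp [Fin.sum_univ_three])
        hsum]⟩
  have hy0 : 0 < y := h0.trans_le hc
  -- A single curve `z = x ^ k` separates two monomials, since `m = k * n`. The middle wedge is
  -- empty, and `a₁`, `b₁` are placeholders satisfying the positivity conditions.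
  rw [hμ'.kendallTau_eq, hμ'.integral_eq_half_sub (fun x => (evCopula_boundary hP x).2.2.2)
    (fun x => (evCopula_boundary hP x).2.2.1),
    integral_deriv_mul_deriv_of_wedges (a₀ := 1 - m) (a₁ := 1 - m) (b₁ := 1) (b₂ := 1 - n)
      (k₁ := k) (k₂ := k) zero_le_one (sub_nonneg.2 n1) hk.le le_rfl (by linarith) (by linarith)
      (by linarith), sub_self, hval, show 1 + k * (1 - n) = y / c by rw [← hval, hm]; ring, hm_def]
  · field_simp
    ring
  · intro x hx z hz h
    rw [squareExtend_of_mem _ hx hz, hC]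
    change x ^ (1 - m) * z ^ (1 - n) * min (x ^ m) (z ^ n) = _
    rw [min_eq_right, mul_assoc, ← Real.rpow_add hz.1, sub_add_cancel, Real.rpow_one]
    rw [hm, Real.rpow_mul hx.1.le]
    exact Real.rpow_le_rpow hz.1.le h.le n0
  · intro x _ z _ h h'
    exact absurd h h'.not_gt
  · intro x hx z hz h
    rw [squareExtend_of_mem _ hx hz, hC]
    change x ^ (1 - m) * z ^ (1 - n) * min (x ^ m) (z ^ n) = _
    rw [min_eq_left, mul_right_comm, ← Real.rpow_add hx.1, sub_add_cancel, Real.rpow_one]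
    rw [hm, Real.rpow_mul hx.1.le]
    exact Real.rpow_le_rpow (Real.rpow_nonneg hx.1.le _) h.le n0

end tent

section threeLines

variable {α β : ℝ}

/-- On each half of the interval one of the two maxima is decided, because `1 - α ≤ β`; the other
contributes a maximum of two lines. -/
theorem max_line_eq_sum (hβ : 0 ≤ β) (hβ' : β ≤ 1) (hαβ : 1 ≤ α + β) {t : ℝ}
    (ht : t ∈ Icc (0 : ℝ) 1) :
    max (max (1 - t) t) (α * t + β * (1 - t)) =
      ∑ i : Fin 2, max (![α, 1 - α] i * t) (![1 - β, β] i * (1 - t)) := by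
  have ht0 := ht.1
  have ht1 := sub_nonneg.2 ht.2
  rw [Fin.sum_univ_two]
  simp only [Matrix.cons_val_zero, Matrix.cons_val_one]
  have key := mul_nonneg (sub_nonneg.2 hαβ) ht0
  have key' := mul_nonneg (sub_nonneg.2 hαβ) ht1
  rcases le_total t (1 - t) with h | h
  · have := mul_le_mul_of_nonneg_left h hβ
    rw [max_eq_left h, max_eq_right (a := (1 - α) * t) (by linarith), ← max_add_add_right, max_comm]
    congr 1
    ring
  · have := mul_le_mul_of_nonneg_left h (sub_nonneg.2 hβ')
    rw [max_eq_right h, max_eq_left (b := (1 - β) * (1 - t)) (by linarith), ← max_add_add_left]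
    congr 1
    ring

theorem kendallTau_max_line (hα : 0 < α) (hα' : α ≤ 1) (hβ : 0 < β) (hβ' : β < 1)
    (hαβ : 1 ≤ α + β) :
    IsPickands (fun t => max (max (1 - t) t) (α * t + β * (1 - t))) ∧
    kendallTau (evCopula fun t => max (max (1 - t) t) (α * t + β * (1 - t))) = 2 - (α + β) := by
  set A : ℝ → ℝ := fun t => max (max (1 - t) t) (α * t + β * (1 - t)) with hA_def
  have hsum : ∀ t ∈ Icc (0 : ℝ) 1, A t =
      ∑ i : Fin 2, max (![α, 1 - α] i * t) (![1 - β, β] i * (1 - t)) :=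
    fun t ht => max_line_eq_sum hβ.le hβ'.le hαβ ht
  have hp : ∀ i, 0 ≤ (![α, 1 - α] : Fin 2 → ℝ) i := by
    intro i; fin_cases i <;> simp [hα.le, hα']
  have hq : ∀ i, 0 ≤ (![1 - β, β] : Fin 2 → ℝ) i := by
    intro i; fin_cases i <;> simp [hβ.le, hβ'.le]
  have hp1 : ∑ i, (![α, 1 - α] : Fin 2 → ℝ) i = 1 := by simp
  have hq1 : ∑ i, (![1 - β, β] : Fin 2 → ℝ) i = 1 := by simp
  have hP : IsPickands A := isPickands_of_eq_sum hp hq hp1 hq1 hsum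
  have hC : ∀ x z : I, evCopula A x z =
      min ((x : ℝ) ^ α) ((z : ℝ) ^ (1 - β)) * min ((x : ℝ) ^ (1 - α)) ((z : ℝ) ^ β) := by
    intro x z
    rw [evCopula_eq_prod hq hp1 hq1 hsum, Fin.prod_univ_two]
    rfl
  obtain ⟨μ, hμ⟩ := exists_hasCDF_prod_min_rpow Finset.univ hp hq
  have hμ' : HasCDF μ (evCopula A) :=
    ⟨hμ.1, fun x z => by rw [hμ.2, evCopula_eq_prod hq hp1 hq1 hsum]⟩
  refine ⟨hP, ?_⟩
  have hβ1 : 0 < 1 - β := sub_pos.2 hβ'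
  have hr : α / (1 - β) * (1 - β) = α := div_mul_cancel₀ _ hβ1.ne'
  have hs : (1 - α) / β * β = 1 - α := div_mul_cancel₀ _ hβ.ne'
  have hs0 : 0 ≤ (1 - α) / β := div_nonneg (by linarith) hβ.le
  -- The separating curves are `x ^ α = z ^ (1 - β)` and `x ^ (1 - α) = z ^ β`. The copula is `z`
  -- below both, `x ^ α * z ^ β` between them and `x` above both.
  have hsr : (1 - α) / β ≤ α / (1 - β) := by
    rw [div_le_div_iff₀ hβ hβ1]
    nlinarith
  have hr0 : 0 < α / (1 - β) := div_pos hα hβ1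
  -- comparison of the two power functions in terms of the separating curves
  have cr : ∀ {x z : ℝ}, 0 < x → 0 ≤ z → (z ≤ x ^ (α / (1 - β)) → z ^ (1 - β) ≤ x ^ α) ∧
      (x ^ (α / (1 - β)) ≤ z → x ^ α ≤ z ^ (1 - β)) := by
    intro x z hx hz
    have e : x ^ α = (x ^ (α / (1 - β))) ^ (1 - β) := by rw [← Real.rpow_mul hx.le, hr]
    rw [e]
    exact ⟨fun h => Real.rpow_le_rpow hz h hβ1.le,
      fun h => Real.rpow_le_rpow (Real.rpow_nonneg hx.le _) h hβ1.le⟩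
  have cs : ∀ {x z : ℝ}, 0 < x → 0 ≤ z → (z ≤ x ^ ((1 - α) / β) → z ^ β ≤ x ^ (1 - α)) ∧
      (x ^ ((1 - α) / β) ≤ z → x ^ (1 - α) ≤ z ^ β) := by
    intro x z hx hz
    have e : x ^ (1 - α) = (x ^ ((1 - α) / β)) ^ β := by rw [← Real.rpow_mul hx.le, hs]
    rw [e]
    exact ⟨fun h => Real.rpow_le_rpow hz h hβ.le,
      fun h => Real.rpow_le_rpow (Real.rpow_nonneg hx.le _) h hβ.le⟩
  have mono : ∀ {x : ℝ}, x ∈ Ioo (0 : ℝ) 1 → x ^ (α / (1 - β)) ≤ x ^ ((1 - α) / β) :=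
    fun hx => Real.rpow_le_rpow_of_exponent_ge hx.1 hx.2.le hsr
  rw [hμ'.kendallTau_eq, hμ'.integral_eq_half_sub (fun x => (evCopula_boundary hP x).2.2.2)
    (fun x => (evCopula_boundary hP x).2.2.1),
    integral_deriv_mul_deriv_of_wedges (a₀ := 0) (a₁ := α) (b₁ := β) (b₂ := 0)
      (k₁ := α / (1 - β)) (k₂ := (1 - α) / β) hβ.le le_rfl hs0 hsr (by linarith)
      (by positivity) (by positivity), hs]
  · have e : α + α / (1 - β) * β = α / (1 - β) := by field_simp; ring
    rw [e, div_div_cancel₀ hα.ne']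
    ring
  · intro x hx z hz h
    rw [squareExtend_of_mem _ hx hz, hC]
    change min (x ^ α) (z ^ (1 - β)) * min (x ^ (1 - α)) (z ^ β) = _
    rw [min_eq_right ((cr hx.1 hz.1.le).1 h.le),
      min_eq_right ((cs hx.1 hz.1.le).1 (h.le.trans (mono hx))), ← Real.rpow_add hz.1,
      sub_add_cancel, Real.rpow_one, Real.rpow_zero, one_mul]
  · intro x hx z hz h h'
    rw [squareExtend_of_mem _ hx hz, hC]
    change min (x ^ α) (z ^ (1 - β)) * min (x ^ (1 - α)) (z ^ β) = _
    rw [min_eq_left ((cr hx.1 hz.1.le).2 h.le), min_eq_right ((cs hx.1 hz.1.le).1 h'.le)]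
  · intro x hx z hz h
    rw [squareExtend_of_mem _ hx hz, hC]
    change min (x ^ α) (z ^ (1 - β)) * min (x ^ (1 - α)) (z ^ β) = _
    rw [min_eq_left ((cr hx.1 hz.1.le).2 ((mono hx).trans h.le)),
      min_eq_left ((cs hx.1 hz.1.le).2 h.le), ← Real.rpow_add hx.1,
      add_sub_cancel, Real.rpow_one, Real.rpow_zero, mul_one]

end threeLines

end

/-! ### Existence of the copula measure and monotonicity of tau -/

section

open Filter Topology in
/-- A pointwise limit of copulas is a copula. -/
theorem exists_hasCDF_of_tendsto {C : ℕ → I → I → ℝ} {D : I → I → ℝ}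
    (hC : ∀ n, ∃ μ, HasCDF μ (C n)) (h1 : ∀ n x, C n x 1 = x) (h2 : ∀ n y, C n 1 y = y)
    (hD : ∀ x y, Tendsto (fun n => C n x y) atTop (𝓝 (D x y))) : ∃ μ, HasCDF μ D := by
  choose μ hμ using hC
  have hprob := fun n => (hμ n).1
  let P : ℕ → ProbabilityMeasure (I × I) := fun n => ⟨μ n, hprob n⟩
  -- Probability measures on the compact square form a compact space, so a limit exists along an
  -- ultrafilter without passing to a subsequence. Its margins stay uniform, hence boxes have null
  -- frontier and their masses converge.
  obtain ⟨Q, -, hQ⟩ := isCompact_univ.ultrafilter_le_nhds ((hyperfilter ℕ).map P) (by simp)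
  have hQ' : Tendsto P (hyperfilter ℕ) (𝓝 Q) := hQ
  have hfst : (Q : Measure (I × I)).map Prod.fst = volume := by
    have h := ProbabilityMeasure.tendsto_map_of_tendsto_of_continuous P Q hQ' continuous_fst
    have e : ∀ n, (P n).map continuous_fst.measurable.aemeasurable =
        (⟨volume, inferInstance⟩ : ProbabilityMeasure I) :=
      fun n => Subtype.ext ((hμ n).map_fst (h1 n))
    simp only [e] at h
    have h' : Q.map continuous_fst.measurable.aemeasurable =
        (⟨volume, inferInstance⟩ : ProbabilityMeasure I) := tendsto_nhds_unique h tendsto_const_nhds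
    exact congrArg Subtype.val h'
  have hsnd : (Q : Measure (I × I)).map Prod.snd = volume := by
    have h := ProbabilityMeasure.tendsto_map_of_tendsto_of_continuous P Q hQ' continuous_snd
    have e : ∀ n, (P n).map continuous_snd.measurable.aemeasurable =
        (⟨volume, inferInstance⟩ : ProbabilityMeasure I) :=
      fun n => Subtype.ext ((hμ n).map_snd (h2 n))
    simp only [e] at h
    have h' : Q.map continuous_snd.measurable.aemeasurable =
        (⟨volume, inferInstance⟩ : ProbabilityMeasure I) := tendsto_nhds_unique h tendsto_const_nhds
    exact congrArg Subtype.val h'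
  refine ⟨Q, inferInstance, fun x y => ?_⟩
  have hfr : (Q : Measure (I × I)) (frontier (Iic x ×ˢ Iic y)) = 0 := by
    have hsub : frontier (Iic x ×ˢ Iic y) ⊆
        (Prod.fst ⁻¹' {x} ∪ Prod.snd ⁻¹' {y} : Set (I × I)) := by
      rw [frontier_prod_eq]
      rintro p (⟨-, h⟩ | ⟨h, -⟩)
      · exact Or.inr (frontier_Iic_subset y h)
      · exact Or.inl (frontier_Iic_subset x h)
    refine measure_mono_null hsub (measure_union_null ?_ ?_)
    · rw [← Measure.map_apply measurable_fst (measurableSet_singleton x), hfst, measure_singleton]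
    · rw [← Measure.map_apply measurable_snd (measurableSet_singleton y), hsnd, measure_singleton]
  have hlim := ProbabilityMeasure.tendsto_measure_of_null_frontier_of_tendsto' hQ' hfr
  have hlim' := (ENNReal.tendsto_toReal (measure_ne_top _ _)).comp hlim
  refine tendsto_nhds_unique hlim' (((hD x y).mono_left Nat.hyperfilter_le_atTop).congr fun n => ?_)
  exact ((hμ n).2 x y).symm

section interpolation

variable {A : ℝ → ℝ}

/-- By convexity the slope on `[s, t]` lies between those on `[0, s]` and `[t, 1]`, which are at
least `-1` and at most `1` since `A s ≥ 1 - s` and `A t ≥ t`. -/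
theorem IsPickands.abs_sub_le (hA : IsPickands A) {s t : ℝ} (hs : s ∈ Icc (0 : ℝ) 1)
    (ht : t ∈ Icc (0 : ℝ) 1) (hst : s ≤ t) : |A t - A s| ≤ t - s := by
  rcases hst.eq_or_lt with rfl | hst
  · simp
  obtain ⟨e0, e1⟩ := hA.endpoints
  have h0 := max_le_iff.1 (hA.max_le s hs)
  have h1 := max_le_iff.1 (hA.max_le t ht)
  have hd : 0 < t - s := sub_pos.2 hst
  rw [abs_le]
  constructor
  · rcases hs.1.eq_or_lt with rfl | hs0
    · linarith
    · have := hA.convexOn.slope_mono_adjacent (x := 0) (by simp) ht hs0 hst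
      rw [e0, sub_zero, div_le_div_iff₀ hs0 hd] at this
      nlinarith
  · rcases ht.2.eq_or_lt with rfl | ht1
    · linarith
    · have := hA.convexOn.slope_mono_adjacent (z := 1) hs (by simp) hst ht1
      rw [e1, div_le_div_iff₀ hd (sub_pos.2 ht1)] at this
      nlinarith

/-- The slopes of the piecewise linear interpolation of `A` on the grid with mesh `1 / N`,
preceded by `-1` and followed by `1`. -/
def gridSlope (A : ℝ → ℝ) (N : ℕ) : ℕ → ℝ
  | 0 => -1
  | i + 1 => if i < N then N * (A ((i + 1 : ℕ) / N) - A (i / N)) else 1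

/-- The slope increments of the piecewise linear interpolation of `A`. -/
def gridWeight (A : ℝ → ℝ) (N i : ℕ) : ℝ := gridSlope A N (i + 1) - gridSlope A N i

theorem grid_mem {N i : ℕ} (h : i ≤ N) : (i / N : ℝ) ∈ Icc (0 : ℝ) 1 :=
  ⟨by positivity, div_le_one_of_le₀ (by exact_mod_cast h) (by positivity)⟩

theorem gridWeight_nonneg (hA : IsPickands A) {N : ℕ} (hN : 0 < N) {i : ℕ} (hi : i ≤ N) :
    0 ≤ gridWeight A N i := by
  have hN' : (0 : ℝ) < N := by exact_mod_cast hN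
  obtain ⟨e0, e1⟩ := hA.endpoints
  have bound : ∀ j, j < N → |N * (A ((j + 1 : ℕ) / N) - A (j / N))| ≤ 1 := fun j hj => by
    have := hA.abs_sub_le (grid_mem hj.le) (grid_mem (Nat.succ_le_of_lt hj))
      (by gcongr; omega)
    rw [abs_mul, abs_of_pos hN']
    refine (mul_le_mul_of_nonneg_left this hN'.le).trans_eq ?_
    push_cast
    field_simp
    ring
  rw [gridWeight, sub_nonneg]
  rcases i with _ | j
  · rw [gridSlope, gridSlope, if_pos hN]
    exact (abs_le.1 (bound 0 hN)).1
  · have hj : j < N := hi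
    rw [gridSlope, gridSlope, if_pos hj]
    split_ifs with h
    · have hx : (j / N : ℝ) < (j + 1 : ℕ) / N := by gcongr; omega
      have hy : ((j + 1 : ℕ) / N : ℝ) < (j + 1 + 1 : ℕ) / N := by gcongr; omega
      have := hA.convexOn.slope_mono_adjacent (grid_mem hj.le)
        (grid_mem (Nat.succ_le_of_lt h)) hx hy
      have d1 : ((j + 1 : ℕ) / N - j / N : ℝ) = 1 / N := by push_cast; ring
      have d2 : ((j + 1 + 1 : ℕ) / N - (j + 1 : ℕ) / N : ℝ) = 1 / N := by push_cast; ring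
      rw [d1, d2, div_le_div_iff_of_pos_right (by positivity)] at this
      exact mul_le_mul_of_nonneg_left this hN'.le
    · exact (abs_le.1 (bound j hj)).2

theorem sum_gridWeight (A : ℝ → ℝ) (N j : ℕ) :
    ∑ i ∈ Finset.range (j + 1), gridWeight A N i = gridSlope A N (j + 1) + 1 := by
  simp only [gridWeight]
  rw [Finset.sum_range_sub, sub_eq_add_neg]
  simp [gridSlope]

/-- The interpolation starts at height `1` with slope `-1`, and the kink at `i / N` raises the slope
by its weight. The case `j = N` supplies the moment conditions on the weights. -/
theorem sum_gridWeight_mul_sub (hA : IsPickands A) {N : ℕ} (hN : 0 < N) {j : ℕ} (hj : j ≤ N) :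
    ∑ i ∈ Finset.range j, gridWeight A N i * (j / N - i / N) = A (j / N) - 1 + j / N := by
  have hN' : (N : ℝ) ≠ 0 := by exact_mod_cast hN.ne'
  induction j with
  | zero => simp [hA.endpoints.1]
  | succ j ih =>
    have hj' : j < N := hj
    have e : ∀ i, gridWeight A N i * ((j + 1 : ℕ) / N - i / N) =
        gridWeight A N i * (j / N - i / N) + gridWeight A N i * (1 / N) := fun i => by
      push_cast; ring
    simp_rw [e]
    rw [Finset.sum_add_distrib, ← Finset.sum_mul, sum_gridWeight, Finset.sum_range_succ,
      ih hj'.le, sub_self, mul_zero, gridSlope, if_pos hj']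
    push_cast
    field_simp
    ring

theorem sum_gridWeight_mul_one_sub (hA : IsPickands A) {N : ℕ} (hN : 0 < N) :
    ∑ i ∈ Finset.range (N + 1), gridWeight A N i * (1 - i / N) = 1 := by
  have hN' : (N : ℝ) ≠ 0 := by exact_mod_cast hN.ne'
  have h := sum_gridWeight_mul_sub hA hN le_rfl
  rw [div_self hN', hA.endpoints.2] at h
  rw [Finset.sum_range_succ, h, div_self hN']
  ring

theorem sum_gridWeight_mul (hA : IsPickands A) {N : ℕ} (hN : 0 < N) :
    ∑ i ∈ Finset.range (N + 1), gridWeight A N i * (i / N) = 1 := by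
  have h := sum_gridWeight_mul_one_sub hA hN
  have h' := sum_gridWeight A N N
  rw [gridSlope, if_neg (lt_irrefl N)] at h'
  simp only [mul_sub, mul_one, Finset.sum_sub_distrib] at h
  linarith

/-- The piecewise linear interpolation of a Pickands function on the grid with mesh `1 / N`. -/
def gridInterp (A : ℝ → ℝ) (N : ℕ) (t : ℝ) : ℝ :=
  ∑ i : Fin (N + 1), max (gridWeight A N i * (1 - (i : ℕ) / N) * t)
    (gridWeight A N i * ((i : ℕ) / N) * (1 - t))

/-- For `θ = i / N`, `max ((1 - θ) * t) (θ * (1 - t))` is `θ * (1 - t)` plus the positive part of `t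
- θ`. The weighted first terms sum to `1 - t`, the second to `A t - 1 + t` at grid points. -/
theorem gridInterp_grid (hA : IsPickands A) {N : ℕ} (hN : 0 < N) {j : ℕ} (hj : j ≤ N) :
    gridInterp A N (j / N) = A (j / N) := by
  have e : ∀ i ∈ Finset.range (N + 1), max (gridWeight A N i * (1 - i / N) * (j / N))
      (gridWeight A N i * (i / N) * (1 - j / N)) =
      gridWeight A N i * (i / N) * (1 - j / N) +
        if i < j then gridWeight A N i * (j / N - i / N) else 0 := by
    intro i hi
    have hw := gridWeight_nonneg hA hN (Nat.lt_succ_iff.1 (Finset.mem_range.1 hi))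
    split_ifs with h
    · have hle : (i / N : ℝ) ≤ j / N := by gcongr
      rw [max_eq_left]
      · ring
      · nlinarith [mul_nonneg hw (sub_nonneg.2 hle)]
    · have hle : (j / N : ℝ) ≤ i / N := by gcongr; omega
      rw [max_eq_right]
      · ring
      · nlinarith [mul_nonneg hw (sub_nonneg.2 hle)]
  rw [gridInterp, Fin.sum_univ_eq_sum_range (fun i => max (gridWeight A N i * (1 - i / N) * (j / N))
      (gridWeight A N i * (i / N) * (1 - j / N))), Finset.sum_congr rfl e, Finset.sum_add_distrib,
    ← Finset.sum_mul, sum_gridWeight_mul hA hN, ← Finset.sum_filter]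
  have hf : (Finset.range (N + 1)).filter (· < j) = Finset.range j := by
    ext i
    simp only [Finset.mem_filter, Finset.mem_range]
    omega
  rw [hf, sum_gridWeight_mul_sub hA hN hj]
  ring

theorem exists_hasCDF_gridInterp (hA : IsPickands A) {N : ℕ} (hN : 0 < N) :
    IsPickands (gridInterp A N) ∧ ∃ μ, HasCDF μ (evCopula (gridInterp A N)) := by
  have hp : ∀ i : Fin (N + 1), 0 ≤ gridWeight A N i * (1 - (i : ℕ) / N) := fun i =>
    mul_nonneg (gridWeight_nonneg hA hN (Nat.lt_succ_iff.1 i.2))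
      (sub_nonneg.2 (grid_mem (Nat.lt_succ_iff.1 i.2)).2)
  have hq : ∀ i : Fin (N + 1), 0 ≤ gridWeight A N i * ((i : ℕ) / N) := fun i =>
    mul_nonneg (gridWeight_nonneg hA hN (Nat.lt_succ_iff.1 i.2))
      (grid_mem (Nat.lt_succ_iff.1 i.2)).1
  have hp1 : ∑ i : Fin (N + 1), gridWeight A N i * (1 - (i : ℕ) / N) = 1 :=
    (Fin.sum_univ_eq_sum_range (fun i => gridWeight A N i * (1 - i / N)) _).trans
      (sum_gridWeight_mul_one_sub hA hN)
  have hq1 : ∑ i : Fin (N + 1), gridWeight A N i * ((i : ℕ) / N) = 1 :=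
    (Fin.sum_univ_eq_sum_range (fun i => gridWeight A N i * (i / N)) _).trans
      (sum_gridWeight_mul hA hN)
  refine ⟨isPickands_of_eq_sum hp hq hp1 hq1 fun _ _ => rfl, ?_⟩
  obtain ⟨μ, hμ⟩ := exists_hasCDF_prod_min_rpow Finset.univ hp hq
  exact ⟨μ, hμ.1, fun x y => (hμ.2 x y).trans
    (evCopula_eq_prod hq hp1 hq1 (fun _ _ => rfl) x y).symm⟩

theorem abs_gridInterp_sub_le (hA : IsPickands A) {N : ℕ} (hN : 0 < N) {t : ℝ}
    (ht : t ∈ Icc (0 : ℝ) 1) : |gridInterp A N t - A t| ≤ 2 / N := by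
  have hN' : (0 : ℝ) < N := by exact_mod_cast hN
  set j := ⌊t * N⌋₊
  have h1 : (j / N : ℝ) ≤ t := by
    rw [div_le_iff₀ hN']
    exact Nat.floor_le (mul_nonneg ht.1 hN'.le)
  have h2 : t - j / N ≤ 1 / N := by
    have := (Nat.lt_floor_add_one (t * N)).le
    rw [← le_div_iff₀ hN', add_div] at this
    linarith
  have hj : j ≤ N := Nat.floor_le_of_le (mul_le_of_le_one_left hN'.le ht.2)
  have a := (exists_hasCDF_gridInterp hA hN).1.abs_sub_le (grid_mem hj) ht h1
  have b := hA.abs_sub_le (grid_mem hj) ht h1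
  rw [gridInterp_grid hA hN hj] at a
  rw [abs_le] at *
  rw [show (2 / N : ℝ) = 1 / N + 1 / N by ring]
  constructor <;> linarith

end interpolation

open Filter Topology in
theorem tendsto_evCopula {A : ℝ → ℝ} {B : ℕ → ℝ → ℝ} (hA : IsPickands A)
    (hB : ∀ n, IsPickands (B n))
    (h : ∀ t ∈ Icc (0 : ℝ) 1, Tendsto (fun n => B n t) atTop (𝓝 (A t))) (x y : I) :
    Tendsto (fun n => evCopula (B n) x y) atTop (𝓝 (evCopula A x y)) := by
  have ht := logRatio_mem x y
  change Tendsto (fun n => ((x : ℝ) * y) ^ B n (logRatio x y)) atTop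
    (𝓝 (((x : ℝ) * y) ^ A (logRatio x y)))
  rcases (mul_nonneg x.2.1 y.2.1).eq_or_lt with h0 | h0
  · simp only [← h0, Real.zero_rpow (hA.pos ht).ne', Real.zero_rpow ((hB _).pos ht).ne',
      tendsto_const_nhds]
  · exact tendsto_const_nhds.rpow (h _ ht) (Or.inl h0.ne')

/-- The extreme-value copula of every Pickands dependence function is a distribution function. -/
theorem IsPickands.exists_hasCDF {A : ℝ → ℝ} (hA : IsPickands A) :
    ∃ μ, HasCDF μ (evCopula A) := by
  have hB := fun n : ℕ => exists_hasCDF_gridInterp hA n.succ_pos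
  refine exists_hasCDF_of_tendsto (fun n => (hB n).2)
    (fun n x => (evCopula_boundary (hB n).1 x).2.2.2)
    (fun n x => (evCopula_boundary (hB n).1 x).2.2.1)
    (tendsto_evCopula hA (fun n => (hB n).1) fun t ht => ?_)
  rw [tendsto_iff_dist_tendsto_zero]
  refine squeeze_zero (fun _ => dist_nonneg) (fun n => abs_gridInterp_sub_le hA n.succ_pos ht) ?_
  exact (tendsto_const_div_atTop_nhds_zero_nat 2).comp (Filter.tendsto_add_atTop_nat 1)

theorem kendallTau_evCopula_mono {A B : ℝ → ℝ} (hA : IsPickands A) (hB : IsPickands B)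
    (h : ∀ t ∈ Icc (0 : ℝ) 1, B t ≤ A t) :
    kendallTau (evCopula A) ≤ kendallTau (evCopula B) := by
  obtain ⟨μ, hμ⟩ := hA.exists_hasCDF
  obtain ⟨ν, hν⟩ := hB.exists_hasCDF
  rw [hμ.kendallTau_eq, hν.kendallTau_eq]
  have := hμ.integral_mono hν (fun x => (evCopula_boundary hA x).2.2.2)
    (fun x => (evCopula_boundary hA x).2.2.1) (fun x => (evCopula_boundary hB x).2.2.2)
    (fun x => (evCopula_boundary hB x).2.2.1) (evCopula_le_evCopula hA hB h)
  linarith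

end

/-! ### The two bounds and their sharpness -/

section

theorem tentT_symm {c y : ℝ} (h0 : 0 < c) (h1 : c < 1) (hy : y ≤ 1) (t : ℝ) :
    tentT (1 - c) y t = tentT c y (1 - t) := by
  rw [tentT_eq_max (sub_pos.2 h1) (by linarith) hy, tentT_eq_max h0 h1 hy, max_comm,
    sub_sub_cancel, sub_sub_cancel]

theorem tentT_mono {c y y' : ℝ} (h0 : 0 < c) (h1 : c < 1) (h : y ≤ y') {t : ℝ}
    (ht : t ∈ Icc (0 : ℝ) 1) : tentT c y t ≤ tentT c y' t := by
  have h1' : 0 < 1 - c := sub_pos.2 h1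
  have e0 : (1 - y') / c ≤ (1 - y) / c := by gcongr
  have e1 : (1 - y') / (1 - c) ≤ (1 - y) / (1 - c) := by gcongr
  rw [tentT, tentT]
  split_ifs
  · nlinarith [mul_le_mul_of_nonneg_right e0 ht.1]
  · nlinarith [mul_le_mul_of_nonneg_right e1 (sub_nonneg.2 ht.2)]

theorem IsPickands.le_tentT {A : ℝ → ℝ} (hA : IsPickands A) {c : ℝ} (h0 : 0 < c) (h1 : c < 1)
    {t : ℝ} (ht : t ∈ Icc (0 : ℝ) 1) : A t ≤ tentT c (A c) t := by
  have hc : c ∈ Icc (0 : ℝ) 1 := ⟨h0.le, h1.le⟩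
  have h1' : 0 < 1 - c := sub_pos.2 h1
  obtain ⟨e0, e1⟩ := hA.endpoints
  rw [tentT]
  split_ifs with h
  · have hle : t / c ≤ 1 := (div_le_one h0).2 h
    have := hA.convexOn.2 (x := 0) (by simp) hc (sub_nonneg.2 hle) (div_nonneg ht.1 h0.le)
      (sub_add_cancel _ _)
    simp only [smul_eq_mul, e0, mul_zero, zero_add, div_mul_cancel₀ _ h0.ne'] at this
    refine this.trans_eq ?_
    ring
  · have hle : (1 - t) / (1 - c) ≤ 1 := (div_le_one h1').2 (by linarith)
    have := hA.convexOn.2 (x := 1) (by simp) hc (sub_nonneg.2 hle)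
      (div_nonneg (sub_nonneg.2 ht.2) h1'.le) (sub_add_cancel _ _)
    have e : (1 - (1 - t) / (1 - c)) * 1 + (1 - t) / (1 - c) * c = t := by
      field_simp
      ring
    simp only [smul_eq_mul, e1] at this
    rw [e] at this
    refine this.trans_eq ?_
    ring

theorem ConvexOn.exists_subgradient {f : ℝ → ℝ} {s : Set ℝ} (hf : ConvexOn ℝ s f) {x : ℝ}
    (hx : x ∈ interior s) : ∃ m, ∀ y ∈ s, f x + m * (y - x) ≤ f y := by
  refine ⟨derivWithin f (Ioi x) x, fun y hy => ?_⟩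
  rcases lt_trichotomy x y with h | rfl | h
  · have := hf.rightDeriv_le_slope_of_mem_interior hx hy h
    rw [slope_def_field, le_div_iff₀ (sub_pos.2 h)] at this
    linarith
  · simp
  · have := (hf.slope_le_leftDeriv_of_mem_interior hy hx h).trans
      (hf.leftDeriv_le_rightDeriv_of_mem_interior hx)
    rw [slope_def_field, div_le_iff₀ (sub_pos.2 h)] at this
    linarith

section bounds

variable {A : ℝ → ℝ} {τ₀ : ℝ}

theorem one_div_le_of_mem_pickandsTau (hτ₀ : 0 ≤ τ₀) (hA : A ∈ pickandsTau τ₀) {t : ℝ}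
    (ht : t ∈ Icc (0 : ℝ) 1) : 1 / (1 + τ₀) ≤ A t := by
  obtain ⟨hP, hτ⟩ := hA
  have h1 : 1 / (1 + τ₀) ≤ 1 := (div_le_one (by linarith)).2 (by linarith)
  rcases ht.1.eq_or_lt with rfl | h0
  · rwa [hP.endpoints.1]
  rcases ht.2.eq_or_lt with rfl | h1'
  · rwa [hP.endpoints.2]
  have hmax := max_le_iff.1 (hP.max_le t ht)
  have hle := hP.le_one t ht
  -- The tent with vertex `(t, A t)` dominates `A`, so its tau is at most `τ₀`.
  have := kendallTau_evCopula_mono (isPickands_tentT h0 h1' hmax.2 hmax.1 hle) hP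
    fun s hs => hP.le_tentT h0 h1' hs
  have hpos := hP.pos ht
  rw [kendallTau_tentT h0 h1' hmax.2 hmax.1 hle, hτ, div_le_iff₀ hpos] at this
  rw [div_le_iff₀ (by linarith)]
  linarith

theorem apply_half_le_of_mem_pickandsTau (hτ₀ : τ₀ ∈ Icc (0 : ℝ) 1) (hA : A ∈ pickandsTau τ₀) :
    A (1 / 2) ≤ 1 - τ₀ / 2 := by
  obtain ⟨hP, hτ⟩ := hA
  by_contra! hlt
  -- The supporting line is lowered to height `b` at `1/2`, which makes its value at `0` strictly
  -- less than `1`; its tau `2 - 2 * b` is still below `τ₀`.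
  obtain ⟨b, hb, hb'⟩ := exists_between hlt
  obtain ⟨s, hs⟩ := hP.convexOn.exists_subgradient (x := 1 / 2)
    (by rw [interior_Icc]; constructor <;> norm_num)
  have s0 := hs 0 (by simp)
  have s1 := hs 1 (by simp)
  rw [hP.endpoints.1] at s0
  rw [hP.endpoints.2] at s1
  have hτ1 := hτ₀.2
  obtain ⟨hB, hν'⟩ := kendallTau_max_line (α := b + s / 2) (β := b - s / 2)
    (by linarith) (by linarith) (by linarith) (by linarith) (by linarith)
  have := kendallTau_evCopula_mono hP hB fun t ht => by
    refine max_le (hP.max_le t ht) ?_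
    linarith [hs t ht]
  rw [hν', hτ] at this
  linarith

end bounds

theorem exists_tentT_eq {τ₀ t y : ℝ} (hτ₀ : τ₀ ∈ Icc (0 : ℝ) 1) (ht : 0 ≤ t) (ht' : t ≤ 1 / 2)
    (h0 : 1 - t ≤ y) (h1 : 1 / (1 + τ₀) ≤ y) (hy : y ≤ 1 - τ₀ * t) :
    ∃ c, 0 < c ∧ c < 1 ∧ c ≤ 1 / (1 + τ₀) ∧ 1 - c ≤ 1 / (1 + τ₀) ∧
      tentT c (1 / (1 + τ₀)) t = y := by
  have hτ := hτ₀.1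
  have hz1 : 1 / (1 + τ₀) ≤ 1 := (div_le_one (by linarith)).2 (by linarith)
  have hz2 : 1 / 2 ≤ 1 / (1 + τ₀) := one_div_le_one_div_of_le (by linarith) (by linarith [hτ₀.2])
  have hz : 1 - 1 / (1 + τ₀) = τ₀ * (1 / (1 + τ₀)) := by field_simp; ring
  set z := 1 / (1 + τ₀)
  have hy1 : y ≤ 1 := hy.trans (by nlinarith)
  rcases hy1.eq_or_lt with rfl | hlt
  -- Here `τ₀ * t = 0`, so the symmetric tent already has value `1` at `t`.
  · refine ⟨1 / 2, by norm_num, by norm_num, hz2, by linarith, ?_⟩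
    have h : τ₀ * t = 0 := le_antisymm (by linarith) (mul_nonneg hτ ht)
    rw [tentT, if_pos ht', hz]
    linear_combination (-2 * z) * h
  · have ht0 : 0 < t := by linarith
    have hd : 0 < 1 - y := sub_pos.2 hlt
    have hzlt : 0 < 1 - z := by linarith
    have hcz : (1 - z) * t / (1 - y) ≤ z := by
      rw [div_le_iff₀ hd, hz]
      nlinarith
    -- This is where the line from `(0, 1)` through `(t, y)` reaches height `z`. The three bounds on
    -- `y` correspond to those on `c`: `y ≤ 1 - τ₀ * t` to `c ≤ z`, `1 - t ≤ y` to `1 - z ≤ c`, and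
    -- `z ≤ y` to `t ≤ c`.
    refine ⟨(1 - z) * t / (1 - y), by positivity, by linarith, hcz, ?_, ?_⟩
    · have : 1 - z ≤ (1 - z) * t / (1 - y) := by
        rw [le_div_iff₀ hd]
        exact mul_le_mul_of_nonneg_left (by linarith) hzlt.le
      linarith
    · rw [tentT, if_pos]
      · field_simp
        ring
      · rw [le_div_iff₀ hd, mul_comm]
        exact mul_le_mul_of_nonneg_right (by linarith) ht

theorem tentT_mem_pickandsTau {τ₀ c : ℝ} (hτ₀ : 0 ≤ τ₀) (h0 : 0 < c) (h1 : c < 1)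
    (hc : c ≤ 1 / (1 + τ₀)) (hc' : 1 - c ≤ 1 / (1 + τ₀)) :
    tentT c (1 / (1 + τ₀)) ∈ pickandsTau τ₀ := by
  have hz : 1 / (1 + τ₀) ≤ 1 := (div_le_one (by linarith)).2 (by linarith)
  refine ⟨isPickands_tentT h0 h1 hc hc' hz, (kendallTau_tentT h0 h1 hc hc' hz).trans ?_⟩
  field_simp
  ring

theorem le_of_lowerL_le {z t y : ℝ} (hz : 1 / 2 ≤ z) (h : lowerL z t ≤ y) :
    1 - t ≤ y ∧ t ≤ y ∧ z ≤ y := by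
  unfold lowerL at h
  split_ifs at h with h1 h2
  all_goals refine ⟨?_, ?_, ?_⟩ <;> linarith

theorem upperU_of_le {v t : ℝ} (ht : t ≤ 1 / 2) : upperU v t = 1 - v * t := by
  rw [upperU, tentT, if_pos ht]
  ring

theorem upperU_symm {v : ℝ} (hv : 0 ≤ v) (t : ℝ) : upperU v (1 - t) = upperU v t := by
  rw [upperU, upperU, ← tentT_symm (by norm_num) (by norm_num) (by linarith)]
  norm_num

theorem mainTheorem2 (τ₀ : ℝ) (hτ₀ : τ₀ ∈ Set.Icc (0 : ℝ) 1) :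
    (∀ A ∈ pickandsTau τ₀, ∀ t ∈ Set.Icc (0 : ℝ) 1,
      lowerL (1 / (1 + τ₀)) t ≤ A t ∧ A t ≤ upperU τ₀ t) ∧
    (∀ p ∈ regionTau τ₀, ∃ A ∈ pickandsTau τ₀, A p.1 = p.2) := by
  refine ⟨fun A hA t ht => ⟨?_, ?_⟩, ?_⟩
  · have hmax := max_le_iff.1 (hA.1.max_le t ht)
    unfold lowerL
    split_ifs
    exacts [hmax.1, one_div_le_of_mem_pickandsTau hτ₀.1 hA ht, hmax.2]
  · exact (hA.1.le_tentT (by norm_num) (by norm_num) ht).trans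
      (tentT_mono (by norm_num) (by norm_num) (apply_half_le_of_mem_pickandsTau hτ₀ hA) ht)
  · rintro ⟨t, y⟩ ⟨⟨ht, -⟩, hl, hu⟩
    have hτ := hτ₀.1
    have hz : 1 / (1 + τ₀) ≤ 1 := (div_le_one (by linarith)).2 (by linarith)
    obtain ⟨l0, l1, l2⟩ := le_of_lowerL_le
      (one_div_le_one_div_of_le (by linarith) (by linarith [hτ₀.2])) hl
    rcases le_total t (1 / 2) with h | h
    · obtain ⟨c, c0, c1, h1, h2, e⟩ := exists_tentT_eq hτ₀ ht.1 h l0 l2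
        (hu.trans_eq (upperU_of_le h))
      exact ⟨_, tentT_mem_pickandsTau hτ c0 c1 h1 h2, e⟩
    · have h' : 1 - t ≤ 1 / 2 := by linarith
      obtain ⟨c, c0, c1, h1, h2, e⟩ := exists_tentT_eq hτ₀ (sub_nonneg.2 ht.2) h'
        (by linarith) l2 (hu.trans_eq ((upperU_symm hτ t).symm.trans (upperU_of_le h')))
      exact ⟨tentT (1 - c) (1 / (1 + τ₀)), tentT_mem_pickandsTau hτ (sub_pos.2 c1) (by linarith) h2
        (by linarith), (tentT_symm c0 c1 hz t).trans e⟩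

end

end
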